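/- Let $d\ge1$ and $n\ge3$, and let $G(d,1,n)$ be the complex reflection group with generators $s_1,\dots,s_n$ and defining relations $s_n^d=1$; $s_i^2=1$ for $1\le i\le n-1$; $s_is_j=s_js_i$ for $j+1<i\le n$; $s_{i+1}s_is_{i+1}=s_is_{i+1}s_i$ for $1\le i\le n-2$; $s_ns_{n-1}s_ns_{n-1}=s_{n-1}s_ns_{n-1}s_n$. A reduced word of an element is a word in $s_1,\dots,s_n$ of minimal length expressing it. An element is fully commutative if any two of its reduced words can be transformed into each other using only the relations $s_is_j=s_js_i$ with $j+1<i$. For $i\ge j$ put $s_{ij}=s_is_{i-1}\cdots s_j$, let $s_{ij}$ be empty for $i<j$, and put $s_{nj}^{(k)}=s_n^k\,s_{n-1,j}$ for $k\ge1$, $1\le j\le n$. Every element of $G(d,1,n)$ is expressed by a unique canonical word $$s_{1i_1}s_{2i_2}\cdots s_{n-1,i_{n-1}}\;s_{nj_1}^{(k_1)}\cdots s_{nj_\ell}^{(k_\ell)},$$ where $1\le i_p\le p+1$, $\ell\ge0$, $1\le j_1<\dots<j_\ell\le n$, and $1\le k_p\le d-1$; the part $s_{nj_1}^{(k_1)}\cdots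 s_{nj_\ell}^{(k_\ell)}$ is its suffix. The collection labeled by a suffix is the set of canonical words that have this suffix and express a fully commutative element. For $0\le k\le n$ the packet $\mathcal P(n,k)$ is the set of the collections labeled by the following suffixes: - for $k=0$: the suffixes with $\ell\ge2$ and $j_1=1$; - for $1\le k\le n-2$: the suffixes $s_{nk}^{(t)}$, and the suffixes with $\ell\ge2$ and $j_1=k+1$; - for $k=n-1$: the suffixes $s_n^t$ and $s_{n,n-1}^{(t)}$; - for $k=n$: the empty suffix. Let $$C(n,k)=\frac{(n+k)!\,(n-k+1)}{k!\,(n+1)!}\quad(0\le k\le n),\qquad \mathfrak F_{n,k}(x)=\sum_{s=0}^{k}C(n,s)\,x^{k-s},\qquad C_n=\frac1{n+1}\binom{2n}{n}.$$ Then the number of fully commutative elements of $G(d,1,n)$ equals $$\sum_{k=0}^{n}C(n,k)\,|\mathcal P(n,k)|=d(d-1)\,\mathfrak F_{n,n-2}(d)+(2d-1)\,C_n-(d-1).$$ In particular, for $d=2$ the number of fully commutative elements of $G(2,1,n)$ is $(n+2)C_n-1$. This recovers Stembridge's count: the Coxeter group of type $B_n$ has $(n+2)C_n-1$ fully commutative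 elements, i.e. elements any two of whose reduced words are related by interchanges of adjacent commuting generators. -/

import Mathlib

namespace FullyComm

/-! ### The group `G(d,1,n)`

The generator `s_i` (`1 ≤ i ≤ n`) is indexed by the element `i - 1` of `Fin n`. -/

/-- The defining relators of `G(d,1,n)`; the generator `s_n` of order `d` is the last one. -/
def relators (d n : ℕ) : Set (FreeGroup (Fin n)) :=
  {r | ∃ i : Fin n, i.val + 1 = n ∧ r = FreeGroup.of i ^ d} ∪
  {r | ∃ i : Fin n, i.val + 1 < n ∧ r = FreeGroup.of i ^ 2} ∪
  {r | ∃ i j : Fin n, j.val + 1 < i.val ∧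
    r = (FreeGroup.of i * FreeGroup.of j) * (FreeGroup.of j * FreeGroup.of i)⁻¹} ∪
  {r | ∃ i j : Fin n, j.val = i.val + 1 ∧ j.val + 1 < n ∧
    r = (FreeGroup.of j * FreeGroup.of i * FreeGroup.of j) *
      (FreeGroup.of i * FreeGroup.of j * FreeGroup.of i)⁻¹} ∪
  {r | ∃ i j : Fin n, j.val = i.val + 1 ∧ j.val + 1 = n ∧
    r = (FreeGroup.of j * FreeGroup.of i * FreeGroup.of j * FreeGroup.of i) *
      (FreeGroup.of i * FreeGroup.of j * FreeGroup.of i * FreeGroup.of j)⁻¹}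

/-- The complex reflection group `G(d,1,n)`, by generators and relations. -/
abbrev G (d n : ℕ) : Type := PresentedGroup (relators d n)

/-- The element of `G(d,1,n)` expressed by a word in the generators. -/
def wordProd (d n : ℕ) (u : List (Fin n)) : G d n :=
  (u.map fun i => (PresentedGroup.of i : G d n)).prod

/-- `R(w)`: the reduced expressions of `w`, i.e. the words of minimal length expressing `w`. -/
def reducedWords (d n : ℕ) (w : G d n) : Set (List (Fin n)) :=
  {u | wordProd d n u = w ∧ ∀ v : List (Fin n), wordProd d n v = w → u.length ≤ v.length}

/-- `v` arises from `u` by interchanging two adjacent letters related by `comm`. -/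
def SwapStep {S : Type*} (comm : S → S → Prop) (u v : List S) : Prop :=
  ∃ (a b : List S) (x y : S), comm x y ∧ u = a ++ x :: y :: b ∧ v = a ++ y :: x :: b

/-- Two words lie in the same commutativity class: the equivalence relation generated by
interchanging adjacent letters related by `comm`. -/
def CommEquiv {S : Type*} (comm : S → S → Prop) : List S → List S → Prop :=
  Relation.EqvGen (SwapStep comm)

/-- `w ∈ G(d,1,n)` is fully commutative: `R(w)` is a single commutativity class, with respect to
the relations `s_i s_j = s_j s_i`, `j + 1 < i`. -/
def IsFullyCommutative (d n : ℕ) (w : G d n) : Prop :=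
  ∀ u ∈ reducedWords d n w, ∀ v ∈ reducedWords d n w,
    CommEquiv (fun i j : Fin n => j.val + 1 < i.val) u v

/-- Full commutativity in the Coxeter group of a Coxeter matrix `M`: any two reduced words
of `w` are related by interchanges of adjacent commuting generators. -/
def CoxeterFullyCommutative {B : Type*} (M : CoxeterMatrix B) (w : M.Group) : Prop :=
  ∀ u v : List B, M.toCoxeterSystem.IsReduced u → M.toCoxeterSystem.IsReduced v →
    M.toCoxeterSystem.wordProd u = w → M.toCoxeterSystem.wordProd v = w →
      CommEquiv (fun i j => M i j = 2) u v

/-! ### Canonical words, collections and packets -/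

/-- The word `s_{ij} = [i, i-1, …, j]` (empty if `i < j`), with labels `i, j` in `{1, …, n}`. -/
def descWord (n i j : ℕ) : List (Fin n) :=
  (List.finRange n).reverse.filter fun a => j ≤ a.val + 1 ∧ a.val + 1 ≤ i

/-- The word `s_{nj}^{(k)} = s_n^k s_{n-1,j}`. -/
def block (n k j : ℕ) : List (Fin n) :=
  (List.replicate k (descWord n n n)).flatten ++ descWord n (n - 1) j

/-- The words `s_{1 i_1} s_{2 i_2} ⋯ s_{n-1 i_{n-1}}` with `1 ≤ i_p ≤ p + 1`. -/
def IsPrefixWord (n : ℕ) (u : List (Fin n)) : Prop :=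
  ∃ i : ℕ → ℕ, (∀ p, 1 ≤ p → p ≤ n - 1 → 1 ≤ i p ∧ i p ≤ p + 1) ∧
    u = ((List.range (n - 1)).map fun p => descWord n (p + 1) (i (p + 1))).flatten

/-- The parameters `(k_1, j_1), …, (k_ℓ, j_ℓ)` of a suffix: `1 ≤ k_p ≤ d - 1` and
`1 ≤ j_1 < ⋯ < j_ℓ ≤ n`. -/
def IsSuffixData (d n : ℕ) (L : List (ℕ × ℕ)) : Prop :=
  (∀ b ∈ L, 1 ≤ b.1 ∧ b.1 < d ∧ 1 ≤ b.2 ∧ b.2 ≤ n) ∧ L.Pairwise fun a b => a.2 < b.2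

/-- The suffix `s_{n j_1}^{(k_1)} ⋯ s_{n j_ℓ}^{(k_ℓ)}`. -/
def suffixWord (n : ℕ) (L : List (ℕ × ℕ)) : List (Fin n) :=
  (L.map fun b => block n b.1 b.2).flatten

/-- The collection labeled by the suffix `v`: the fully commutative canonical words with
suffix `v`. -/
def collection (d n : ℕ) (v : List (Fin n)) : Set (List (Fin n)) :=
  {w | ∃ u, IsPrefixWord n u ∧ w = u ++ v ∧ IsFullyCommutative d n (wordProd d n w)}

/-- The suffixes labeling the collections in the `(n,k)`-packet. -/
def PacketLabel (n k : ℕ) (L : List (ℕ × ℕ)) : Prop :=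
  (k = 0 ∧ ∃ t b M, L = (t, 1) :: b :: M) ∨
  (1 ≤ k ∧ k + 2 ≤ n ∧ ((∃ t, L = [(t, k)]) ∨ ∃ t b M, L = (t, k + 1) :: b :: M)) ∨
  (k + 1 = n ∧ ∃ t, L = [(t, n)] ∨ L = [(t, n - 1)]) ∨
  (k = n ∧ L = [])

/-- The `(n,k)`-packet `𝒫(n,k)` of `G(d,1,n)`, a set of collections. -/
def packet (d n k : ℕ) : Set (Set (List (Fin n))) :=
  {c | ∃ L, IsSuffixData d n L ∧ PacketLabel n k L ∧ c = collection d n (suffixWord n L)}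

/-! ### Catalan triangle -/

/-- The Catalan triangle number `C(n,k) = (n+k)! (n-k+1) / (k! (n+1)!)`, for `0 ≤ k ≤ n`. -/
def catalanTriangle (n k : ℕ) : ℚ :=
  ((n + k).factorial * ((n : ℚ) - k + 1)) / (k.factorial * (n + 1).factorial)

/-- The Catalan triangle polynomial `𝔉_{n,k}(x) = ∑_{s=0}^k C(n,s) x^{k-s}`. -/
noncomputable def catalanTrianglePoly (n k : ℕ) : Polynomial ℚ :=
  ∑ s ∈ Finset.range (k + 1),
    Polynomial.C (catalanTriangle n s) * Polynomial.X ^ (k - s)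

end FullyComm

namespace FullyComm

/-! ### Words over `ℕ` -/

/-- The descending word `[p - 1, p - 2, …, e]`, empty if `p ≤ e`. -/
def dsc : ℕ → ℕ → List ℕ
  | 0, _ => []
  | p + 1, e => if e ≤ p then p :: dsc p e else []

theorem dsc_of_le {p e : ℕ} (h : p ≤ e) : dsc p e = [] := by
  cases p with
  | zero => rfl
  | succ p => simp [dsc]; omega

theorem dsc_succ {p e : ℕ} (h : e ≤ p) : dsc (p + 1) e = p :: dsc p e := by
  simp [dsc, h]

theorem mem_dsc {p e x : ℕ} : x ∈ dsc p e ↔ e ≤ x ∧ x < p := by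
  induction p with
  | zero => simp [dsc]
  | succ p ih =>
    by_cases h : e ≤ p
    · rw [dsc_succ h, List.mem_cons, ih]; omega
    · rw [dsc_of_le (by omega)]; simp; omega

theorem dsc_append {p q e : ℕ} (h1 : e ≤ q) (h2 : q ≤ p) : dsc p e = dsc p q ++ dsc q e := by
  induction p with
  | zero => obtain rfl : q = 0 := by omega
            simp [dsc]
  | succ p ih =>
    rcases Nat.lt_or_ge p q with h | h
    · obtain rfl : q = p + 1 := by omega
      rw [dsc_of_le (le_refl (p + 1)), List.nil_append]
    · rw [dsc_succ (h1.trans h), dsc_succ h, ih h, List.cons_append]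

theorem dsc_snoc {p e : ℕ} (h : e < p) : dsc p e = dsc p (e + 1) ++ [e] := by
  rw [dsc_append (Nat.le_succ e) h, dsc_succ le_rfl, dsc_of_le le_rfl]

/-! ### Products of words in a monoid -/

section Monoid

variable {M : Type*} [Monoid M] (g : ℕ → M)

/-- The value of a word in a monoid, given the values of the letters. -/
def ev (w : List ℕ) : M := (w.map g).prod

@[simp] theorem ev_nil : ev g [] = 1 := rfl

@[simp] theorem ev_cons (a : ℕ) (w : List ℕ) : ev g (a :: w) = g a * ev g w := by simp [ev]

@[simp] theorem ev_append (u v : List ℕ) : ev g (u ++ v) = ev g u * ev g v := by simp [ev]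

@[simp] theorem ev_replicate (k a : ℕ) : ev g (List.replicate k a) = g a ^ k := by simp [ev]

theorem commute_ev (hc : ∀ i j, i + 1 < j → Commute (g i) (g j)) {x : ℕ} {w : List ℕ}
    (h : ∀ y ∈ w, x + 1 < y ∨ y + 1 < x) : Commute (g x) (ev g w) := by
  induction w with
  | nil => simp
  | cons a w ih =>
    rw [ev_cons]
    refine Commute.mul_right ?_ (ih fun y hy => h y (by simp [hy]))
    rcases h a (by simp) with h | h
    · exact hc _ _ h
    · exact (hc _ _ h).symm

/-- The letter b + 1 commutes left past everything below b, one braid relation turns it into b, and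
b commutes past the letters above b + 1: a letter crossing a descending run drops by one. -/
theorem ev_dsc_mul {N : ℕ} (hc : ∀ i j, i + 1 < j → Commute (g i) (g j))
    (hb : ∀ i, i + 1 < N → g i * g (i + 1) * g i = g (i + 1) * g i * g (i + 1))
    {p e b : ℕ} (hp : p ≤ N) (he : e ≤ b) (hbp : b + 1 < p) :
    ev g (dsc p e) * g (b + 1) = g b * ev g (dsc p e) := by
  have h1 : dsc p e = dsc p (b + 2) ++ (b + 1) :: b :: dsc b e := by
    rw [dsc_append (q := b + 2) (by omega) (by omega), dsc_succ (p := b + 1) (by omega),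
      dsc_succ (p := b) he]
  have c1 : Commute (g (b + 1)) (ev g (dsc b e)) :=
    commute_ev g hc fun y hy => by rw [mem_dsc] at hy; omega
  have c2 : Commute (g b) (ev g (dsc p (b + 2))) :=
    commute_ev g hc fun y hy => by rw [mem_dsc] at hy; omega
  rw [h1]
  simp only [ev_append, ev_cons, mul_assoc]
  rw [← c1.eq, ← mul_assoc (g (b + 1)) (g b), ← mul_assoc (g (b + 1) * g b), ← hb b (by omega)]
  simp only [← mul_assoc]
  rw [c2.eq]

theorem ev_dsc_mul_dsc {N : ℕ} (hc : ∀ i j, i + 1 < j → Commute (g i) (g j))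
    (hb : ∀ i, i + 1 < N → g i * g (i + 1) * g i = g (i + 1) * g i * g (i + 1))
    {p e : ℕ} (hp : p ≤ N) (q : ℕ) (hq : q + 1 ≤ p) :
    ev g (dsc p e) * ev g (dsc (q + 1) (e + 1)) = ev g (dsc q e) * ev g (dsc p e) := by
  induction q with
  | zero => rw [dsc_of_le (p := 0 + 1) (by omega), dsc_of_le (p := 0) (by omega)]; simp
  | succ q ih =>
    by_cases h : e ≤ q
    · rw [dsc_succ (p := q + 1) (by omega), dsc_succ (p := q) h, ev_cons, ev_cons, ← mul_assoc,
        ev_dsc_mul g hc hb hp h (by omega), mul_assoc, ih (by omega), mul_assoc]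
    · rw [dsc_of_le (p := q + 1 + 1) (by omega), dsc_of_le (p := q + 1) (by omega)]; simp

/-- Two suffix blocks with the same end can be put in canonical order: the exponents trade places,
the second block ends one letter later, and one letter s is released on the left. -/
theorem ev_block_mul_block {s : ℕ} (hc : ∀ i j, i + 1 < j → Commute (g i) (g j))
    (hb : ∀ i, i + 1 < s + 1 → g i * g (i + 1) * g i = g (i + 1) * g i * g (i + 1))
    (ht : ∀ a b, 1 ≤ a → 1 ≤ b →
      g (s + 1) ^ a * g s * g (s + 1) ^ b * g s = g s * g (s + 1) ^ b * g s * g (s + 1) ^ a)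
    {a k l : ℕ} (ha : a ≤ s) (hk : 1 ≤ k) (hl : 1 ≤ l) :
    g (s + 1) ^ k * ev g (dsc (s + 1) a) * (g (s + 1) ^ l * ev g (dsc (s + 1) a)) =
      g s * (g (s + 1) ^ l * ev g (dsc (s + 1) a) *
        (g (s + 1) ^ k * ev g (dsc (s + 1) (a + 1)))) := by
  have c : Commute (g (s + 1)) (ev g (dsc s a)) :=
    commute_ev g hc fun y hy => by rw [mem_dsc] at hy; omega
  have h1 := ev_dsc_mul_dsc g hc hb (p := s + 1) (e := a) le_rfl s le_rfl
  have h2 : ev g (dsc (s + 1) a) = g s * ev g (dsc s a) := by rw [dsc_succ ha, ev_cons]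
  calc g (s + 1) ^ k * ev g (dsc (s + 1) a) * (g (s + 1) ^ l * ev g (dsc (s + 1) a))
      = g (s + 1) ^ k * g s * (ev g (dsc s a) * g (s + 1) ^ l) * ev g (dsc (s + 1) a) := by
        rw [h2]; simp only [mul_assoc]
    _ = g (s + 1) ^ k * g s * g (s + 1) ^ l * (ev g (dsc s a) * ev g (dsc (s + 1) a)) := by
        rw [← (c.pow_left l).eq]; simp only [mul_assoc]
    _ = (g (s + 1) ^ k * g s * g (s + 1) ^ l * g s) * ev g (dsc s a) *
          ev g (dsc (s + 1) (a + 1)) := by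
        rw [← h1, h2]; simp only [mul_assoc]
    _ = g s * g (s + 1) ^ l * g s * (g (s + 1) ^ k * ev g (dsc s a)) *
          ev g (dsc (s + 1) (a + 1)) := by
        rw [ht k l hk hl]; simp only [mul_assoc]
    _ = _ := by rw [(c.pow_left k).eq, h2]; simp only [mul_assoc]

end Monoid

/-! ### Commutation and braid equivalence -/

/-- Commutation equivalence of words over `ℕ`. -/
abbrev Cm : List ℕ → List ℕ → Prop := CommEquiv fun i j : ℕ => j + 1 < i

/-- The pairs of words exchanged by the proper braid relations; `N` is the label of the last
generator. -/
inductive BraidRel (N : ℕ) : List ℕ → List ℕ → Prop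
  | braid (i : ℕ) (h : i + 1 < N) : BraidRel N [i, i + 1, i] [i + 1, i, i + 1]
  | last (s a b : ℕ) (h : s + 1 = N) (ha : 1 ≤ a) (hb : 1 ≤ b) :
      BraidRel N (List.replicate a N ++ s :: (List.replicate b N ++ [s]))
        (s :: (List.replicate b N ++ s :: List.replicate a N))

/-- A single commutation or braid move. -/
def BraidStep (N : ℕ) (u v : List ℕ) : Prop :=
  SwapStep (fun i j : ℕ => j + 1 < i) u v ∨
    ∃ a b l r, BraidRel N l r ∧ u = a ++ l ++ b ∧ v = a ++ r ++ b

/-- The equivalence relation on words generated by commutations and braid moves. -/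
def Br (N : ℕ) : List ℕ → List ℕ → Prop := Relation.EqvGen (BraidStep N)

theorem SwapStep.append {S : Type*} {c : S → S → Prop} {u v : List S} (h : SwapStep c u v)
    (p q : List S) : SwapStep c (p ++ u ++ q) (p ++ v ++ q) := by
  obtain ⟨a, b, x, y, hxy, rfl, rfl⟩ := h
  exact ⟨p ++ a, b ++ q, x, y, hxy, by simp, by simp⟩

theorem BraidStep.append {N : ℕ} {u v : List ℕ} (h : BraidStep N u v) (p q : List ℕ) :
    BraidStep N (p ++ u ++ q) (p ++ v ++ q) := by
  rcases h with h | ⟨a, b, l, r, hlr, rfl, rfl⟩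
  · exact Or.inl (h.append p q)
  · exact Or.inr ⟨p ++ a, b ++ q, l, r, hlr, by simp, by simp⟩

theorem eqvGen_map {α β : Type*} {r : α → α → Prop} {r' : β → β → Prop} (f : α → β)
    (h : ∀ u v, r u v → Relation.EqvGen r' (f u) (f v)) {u v : α} (huv : Relation.EqvGen r u v) :
    Relation.EqvGen r' (f u) (f v) := by
  induction huv with
  | rel u v huv => exact h u v huv
  | refl u => exact .refl _
  | symm u v _ ih => exact ih.symm
  | trans u v w _ _ ih1 ih2 => exact ih1.trans _ _ _ ih2

theorem CommEquiv.append {S : Type*} {c : S → S → Prop} {u v u' v' : List S}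
    (h : CommEquiv c u v) (h' : CommEquiv c u' v') : CommEquiv c (u ++ u') (v ++ v') := by
  refine .trans _ (v ++ u') _ ?_ ?_
  · exact eqvGen_map (fun w => w ++ u')
      (fun a b hab => .rel _ _ (by simpa using hab.append [] u')) h
  · exact eqvGen_map (fun w => v ++ w) (fun a b hab => .rel _ _ (by simpa using hab.append v [])) h'

theorem Br.append {N : ℕ} {u v u' v' : List ℕ}
    (h : Br N u v) (h' : Br N u' v') : Br N (u ++ u') (v ++ v') := by
  refine .trans _ (v ++ u') _ ?_ ?_
  · exact eqvGen_map (fun w => w ++ u')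
      (fun a b hab => .rel _ _ (by simpa using hab.append [] u')) h
  · exact eqvGen_map (fun w => v ++ w) (fun a b hab => .rel _ _ (by simpa using hab.append v [])) h'

theorem Br.trans {N : ℕ} {u v w : List ℕ} (h : Br N u v) (h' : Br N v w) : Br N u w :=
  Relation.EqvGen.trans _ _ _ h h'

theorem Br.refl {N : ℕ} (u : List ℕ) : Br N u u := Relation.EqvGen.refl u

theorem Cm.br {u v : List ℕ} (N : ℕ) (h : Cm u v) : Br N u v :=
  eqvGen_map (r' := BraidStep N) id (fun _ _ h => .rel _ _ (Or.inl h)) h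

/-- Commutation equivalence as a congruence on the free monoid. -/
def cmCon : Con (FreeMonoid ℕ) where
  r u v := Cm u.toList v.toList
  iseqv := ⟨fun _ => .refl _, fun h => h.symm, fun h h' => h.trans _ _ _ h'⟩
  mul' h h' := CommEquiv.append h h'

/-- Braid equivalence as a congruence on the free monoid. -/
def brCon (N : ℕ) : Con (FreeMonoid ℕ) where
  r u v := Br N u.toList v.toList
  iseqv := ⟨fun _ => .refl _, fun h => h.symm, fun h h' => h.trans h'⟩
  mul' h h' := Br.append h h'

/-- The letters in the trace monoid. -/
def cmGen (i : ℕ) : cmCon.Quotient := (FreeMonoid.of i : FreeMonoid ℕ)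

/-- The letters in the braid monoid. -/
def brGen (N i : ℕ) : (brCon N).Quotient := (FreeMonoid.of i : FreeMonoid ℕ)

theorem ev_cmGen (u : List ℕ) :
    ev cmGen u = ((FreeMonoid.ofList u : FreeMonoid ℕ) : cmCon.Quotient) := by
  induction u with
  | nil => rfl
  | cons a u ih => rw [ev_cons, ih]; rfl

theorem ev_brGen (N : ℕ) (u : List ℕ) :
    ev (brGen N) u = ((FreeMonoid.ofList u : FreeMonoid ℕ) : (brCon N).Quotient) := by
  induction u with
  | nil => rfl
  | cons a u ih => rw [ev_cons, ih]; rfl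

/-- Equivalences of words become equations in a quotient monoid, where the monoid computations above
apply. -/
theorem ev_cmGen_eq_iff {u v : List ℕ} : ev cmGen u = ev cmGen v ↔ Cm u v := by
  rw [ev_cmGen, ev_cmGen, Con.eq]; rfl

theorem ev_brGen_eq_iff {N : ℕ} {u v : List ℕ} : ev (brGen N) u = ev (brGen N) v ↔ Br N u v := by
  rw [ev_brGen, ev_brGen, Con.eq]; rfl

theorem cmGen_commute (i j : ℕ) (h : i + 1 < j) : Commute (cmGen i) (cmGen j) := by
  have : ev cmGen [j, i] = ev cmGen [i, j] :=
    ev_cmGen_eq_iff.2 (.rel _ _ ⟨[], [], j, i, h, rfl, rfl⟩)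
  exact Eq.symm (by simpa using this)

theorem brGen_commute (N i j : ℕ) (h : i + 1 < j) : Commute (brGen N i) (brGen N j) := by
  have : ev (brGen N) [j, i] = ev (brGen N) [i, j] :=
    ev_brGen_eq_iff.2 (.rel _ _ (Or.inl ⟨[], [], j, i, h, rfl, rfl⟩))
  exact Eq.symm (by simpa using this)

theorem BraidRel.br {N : ℕ} {l r : List ℕ} (h : BraidRel N l r) : Br N l r :=
  .rel _ _ (Or.inr ⟨[], [], l, r, h, by simp, by simp⟩)

theorem brGen_braid (N i : ℕ) (h : i + 1 < N) :
    brGen N i * brGen N (i + 1) * brGen N i = brGen N (i + 1) * brGen N i * brGen N (i + 1) := by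
  have := ev_brGen_eq_iff.2 (BraidRel.braid i h).br
  simpa [mul_assoc] using this

theorem brGen_last (s a b : ℕ) (ha : 1 ≤ a) (hb : 1 ≤ b) :
    brGen (s + 1) (s + 1) ^ a * brGen (s + 1) s * brGen (s + 1) (s + 1) ^ b * brGen (s + 1) s =
      brGen (s + 1) s * brGen (s + 1) (s + 1) ^ b * brGen (s + 1) s *
        brGen (s + 1) (s + 1) ^ a := by
  have := ev_brGen_eq_iff.2 (BraidRel.last s a b rfl ha hb).br
  simpa [mul_assoc] using this

theorem cm_far {x : ℕ} {w : List ℕ} (h : ∀ y ∈ w, x + 1 < y ∨ y + 1 < x) :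
    Cm (x :: w) (w ++ [x]) := by
  rw [← ev_cmGen_eq_iff]
  simpa using (commute_ev cmGen cmGen_commute h).eq

theorem BraidRel.length_eq {N : ℕ} {l r : List ℕ} (h : BraidRel N l r) : l.length = r.length := by
  cases h with
  | braid => rfl
  | last => simp; omega

theorem Br.length_eq {N : ℕ} {u v : List ℕ} (h : Br N u v) : u.length = v.length := by
  induction h with
  | rel u v huv =>
    rcases huv with ⟨a, b, x, y, -, rfl, rfl⟩ | ⟨a, b, l, r, hlr, rfl, rfl⟩
    · simp
    · simp [hlr.length_eq]
  | refl u => rfl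
  | symm u v _ ih => exact ih.symm
  | trans u v w _ _ ih1 ih2 => exact ih1.trans ih2

/-! ### Evaluation in `G(d,1,N+1)` -/

/-- The word over `Fin (N + 1)` obtained by deleting the letters greater than `N`. -/
def lift (N : ℕ) (u : List ℕ) : List (Fin (N + 1)) :=
  u.filterMap fun i => if h : i ≤ N then some ⟨i, Nat.lt_succ_of_le h⟩ else none

theorem lift_append (N : ℕ) (u v : List ℕ) : lift N (u ++ v) = lift N u ++ lift N v := by
  simp [lift]

theorem lift_cons (N a : ℕ) (u : List ℕ) : lift N (a :: u) = lift N [a] ++ lift N u :=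
  lift_append N [a] u

theorem lift_singleton {N a : ℕ} (h : a < N + 1) : lift N [a] = [⟨a, h⟩] := by
  simp [lift, Nat.le_of_lt_succ h]

theorem lift_singleton_of_lt {N a : ℕ} (h : ¬ a < N + 1) : lift N [a] = [] := by
  simp only [lift, List.filterMap_cons, List.filterMap_nil]
  rw [dif_neg (by omega)]

theorem lift_map_val (N : ℕ) (u : List (Fin (N + 1))) : lift N (u.map Fin.val) = u := by
  induction u with
  | nil => rfl
  | cons a u ih =>
    rw [List.map_cons, lift_cons, lift_singleton a.2, ih]
    rfl

theorem map_val_lift {N : ℕ} {u : List ℕ} (h : ∀ x ∈ u, x ≤ N) : (lift N u).map Fin.val = u := by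
  induction u with
  | nil => rfl
  | cons a u ih =>
    have ha : a < N + 1 := Nat.lt_succ_of_le (h a (by simp))
    have := ih fun x hx => h x (by simp [hx])
    rw [lift_cons, lift_singleton ha, List.map_append, this]
    rfl

theorem commEquiv_lift (N : ℕ) {u v : List ℕ} (h : Cm u v) :
    CommEquiv (fun i j : Fin (N + 1) => j.val + 1 < i.val) (lift N u) (lift N v) := by
  refine eqvGen_map (lift N) ?_ h
  rintro _ _ ⟨a, b, x, y, hxy, rfl, rfl⟩
  by_cases hx : x < N + 1
  · have hy : y < N + 1 := by omega
    refine .rel _ _ ⟨lift N a, lift N b, ⟨x, hx⟩, ⟨y, hy⟩, hxy, ?_, ?_⟩ <;>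
      rw [lift_append, lift_cons, lift_cons _ _ b, lift_singleton hx, lift_singleton hy] <;> rfl
  · have : lift N (a ++ x :: y :: b) = lift N (a ++ y :: x :: b) := by
      rw [lift_append, lift_append, lift_cons N x (y :: b), lift_cons N y b, lift_cons N y (x :: b),
        lift_cons N x b, lift_singleton_of_lt hx]
      rfl
    rw [this]
    exact .refl _

theorem commEquiv_map_val (N : ℕ) {u v : List (Fin (N + 1))}
    (h : CommEquiv (fun i j : Fin (N + 1) => j.val + 1 < i.val) u v) :
    Cm (u.map Fin.val) (v.map Fin.val) := by
  refine eqvGen_map (List.map Fin.val) ?_ h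
  rintro _ _ ⟨a, b, x, y, hxy, rfl, rfl⟩
  exact .rel _ _ ⟨a.map Fin.val, b.map Fin.val, x, y, hxy, by simp, by simp⟩

theorem wordProd_append (d n : ℕ) (u v : List (Fin n)) :
    wordProd d n (u ++ v) = wordProd d n u * wordProd d n v := by simp [wordProd]

/-- The value in `G(d,1,N+1)` of a word over `ℕ`. -/
def wp (d N : ℕ) (u : List ℕ) : G d (N + 1) := wordProd d (N + 1) (lift N u)

theorem wp_append (d N : ℕ) (u v : List ℕ) : wp d N (u ++ v) = wp d N u * wp d N v := by
  simp [wp, lift_append, wordProd_append]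

@[simp] theorem wp_nil (d N : ℕ) : wp d N [] = 1 := rfl

theorem wp_cons (d N a : ℕ) (u : List ℕ) : wp d N (a :: u) = wp d N [a] * wp d N u :=
  wp_append d N [a] u

theorem wp_replicate (d N k a : ℕ) : wp d N (List.replicate k a) = wp d N [a] ^ k := by
  induction k with
  | zero => simp
  | succ k ih => rw [List.replicate_succ, wp_cons, ih, pow_succ']

theorem wp_map_val (d N : ℕ) (u : List (Fin (N + 1))) :
    wp d N (u.map Fin.val) = wordProd d (N + 1) u := by rw [wp, lift_map_val]

theorem wp_singleton (d : ℕ) {N a : ℕ} (h : a < N + 1) :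
    wp d N [a] = PresentedGroup.of ⟨a, h⟩ := by
  simp [wp, lift_singleton h, wordProd]

theorem mk_eq_of_mem_relators {d n : ℕ} {a b : FreeGroup (Fin n)} (h : a * b⁻¹ ∈ relators d n) :
    PresentedGroup.mk (relators d n) a = PresentedGroup.mk (relators d n) b := by
  have := PresentedGroup.one_of_mem h
  rwa [map_mul, map_inv, mul_inv_eq_one] at this

theorem wp_last_pow (d N : ℕ) : wp d N [N] ^ d = 1 := by
  rw [wp_singleton d (Nat.lt_succ_self N)]
  exact PresentedGroup.one_of_mem (rels := relators d (N + 1))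
    (x := FreeGroup.of ⟨N, Nat.lt_succ_self N⟩ ^ d)
    (Or.inl (Or.inl (Or.inl (Or.inl ⟨⟨N, Nat.lt_succ_self N⟩, rfl, rfl⟩))))

theorem wp_sq (d : ℕ) {N a : ℕ} (h : a < N) : wp d N [a] * wp d N [a] = 1 := by
  rw [wp_singleton d (by omega : a < N + 1), ← pow_two]
  exact PresentedGroup.one_of_mem (rels := relators d (N + 1))
    (x := FreeGroup.of ⟨a, by omega⟩ ^ 2)
    (Or.inl (Or.inl (Or.inl (Or.inr ⟨⟨a, by omega⟩, by simpa using h, rfl⟩))))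

theorem wp_far (d N : ℕ) {i j : ℕ} (h : j + 1 < i) :
    wp d N [i] * wp d N [j] = wp d N [j] * wp d N [i] := by
  by_cases hi : i < N + 1
  · rw [wp_singleton d hi, wp_singleton d (by omega : j < N + 1)]
    exact mk_eq_of_mem_relators (Or.inl (Or.inl (Or.inr ⟨⟨i, hi⟩, ⟨j, by omega⟩, h, rfl⟩)))
  · have : wp d N [i] = 1 := by simp [wp, lift_singleton_of_lt hi, wordProd]
    simp [this]

theorem wp_braid (d : ℕ) {N i : ℕ} (h : i + 1 < N) :
    wp d N [i + 1] * wp d N [i] * wp d N [i + 1] = wp d N [i] * wp d N [i + 1] * wp d N [i] := by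
  rw [wp_singleton d (by omega : i + 1 < N + 1), wp_singleton d (by omega : i < N + 1)]
  exact mk_eq_of_mem_relators
    (Or.inl (Or.inr ⟨⟨i, by omega⟩, ⟨i + 1, by omega⟩, rfl, by simpa using h, rfl⟩))

theorem wp_last_braid (d s : ℕ) :
    wp d (s + 1) [s + 1] * wp d (s + 1) [s] * wp d (s + 1) [s + 1] * wp d (s + 1) [s] =
      wp d (s + 1) [s] * wp d (s + 1) [s + 1] * wp d (s + 1) [s] * wp d (s + 1) [s + 1] := by
  rw [wp_singleton d (by omega : s + 1 < s + 1 + 1), wp_singleton d (by omega : s < s + 1 + 1)]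
  exact mk_eq_of_mem_relators
    (Or.inr ⟨⟨s, by omega⟩, ⟨s + 1, by omega⟩, rfl, rfl, rfl⟩)

/-- With x the letter s, t the last letter and x an involution, x t^b x = (x t x)^b, so the
commutation of t with x t x passes to powers. For b > 1 this needs x² = 1 and does not follow from
the plain braid relation alone, which is why `BraidRel.last` carries exponents. -/
theorem wp_last (d s a b : ℕ) :
    wp d (s + 1) [s + 1] ^ a * wp d (s + 1) [s] * wp d (s + 1) [s + 1] ^ b * wp d (s + 1) [s] =
      wp d (s + 1) [s] * wp d (s + 1) [s + 1] ^ b * wp d (s + 1) [s] *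
        wp d (s + 1) [s + 1] ^ a := by
  have hs := wp_sq d (Nat.lt_succ_self s)
  have h := wp_last_braid d s
  generalize wp d (s + 1) [s] = x at *
  generalize wp d (s + 1) [s + 1] = t at *
  have hx : x⁻¹ = x := inv_eq_of_mul_eq_one_left hs
  have hconj : x * t ^ b * x = (x * t * x) ^ b := by
    have := conj_pow (i := b) (a := x) (b := t)
    rwa [hx, eq_comm] at this
  have hcomm : Commute t (x * t * x) := by
    show _ = _
    simpa only [mul_assoc] using h
  have := (hcomm.pow_pow a b).eq
  rw [← hconj] at this
  simpa only [mul_assoc] using this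

theorem BraidRel.wp_eq {d N : ℕ} {l r : List ℕ} (h : BraidRel N l r) : wp d N l = wp d N r := by
  cases h with
  | braid i h =>
    have := wp_braid d h
    rw [wp_cons d N i [i + 1, i], wp_cons d N (i + 1) [i], wp_cons d N (i + 1) [i, i + 1],
      wp_cons d N i [i + 1], ← mul_assoc, ← mul_assoc, this]
  | last s a b h ha hb =>
    subst h
    have := wp_last d s a b
    rw [wp_append, wp_cons _ _ s (_ ++ [s]), wp_append, wp_cons _ _ s (_ ++ _), wp_append,
      wp_cons _ _ s (List.replicate a _), wp_replicate, wp_replicate]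
    simpa only [mul_assoc] using this

theorem Br.wp_eq {N : ℕ} {u v : List ℕ} (d : ℕ) (h : Br N u v) : wp d N u = wp d N v := by
  induction h with
  | rel u v huv =>
    rcases huv with ⟨a, b, x, y, hxy, rfl, rfl⟩ | ⟨a, b, l, r, hlr, rfl, rfl⟩
    · have := wp_far d N hxy
      rw [wp_append, wp_append, wp_cons _ _ x, wp_cons _ _ y, wp_cons _ _ y (x :: b),
        wp_cons _ _ x b, ← mul_assoc (wp d N [x]), this, mul_assoc]
    · rw [wp_append, wp_append, wp_append, wp_append, hlr.wp_eq]
  | refl u => rfl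
  | symm u v _ ih => exact ih.symm
  | trans u v w _ _ ih1 ih2 => exact ih1.trans ih2

/-! ### Non-lengthening rewriting -/

/-- `v` expresses the same element as `u`, and is either shorter or braid equivalent to `u`. -/
def Red (d N : ℕ) (u v : List ℕ) : Prop :=
  wp d N u = wp d N v ∧ (v.length < u.length ∨ Br N u v)

theorem Br.red {N : ℕ} {u v : List ℕ} (d : ℕ) (h : Br N u v) : Red d N u v := ⟨h.wp_eq d, Or.inr h⟩

theorem Red.refl {d N : ℕ} (u : List ℕ) : Red d N u u := Br.red d (.refl u)

theorem Red.trans {d N : ℕ} {u v w : List ℕ} (h : Red d N u v) (h' : Red d N v w) :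
    Red d N u w := by
  refine ⟨h.1.trans h'.1, ?_⟩
  rcases h.2 with h1 | h1 <;> rcases h'.2 with h2 | h2
  · exact Or.inl (h2.trans h1)
  · exact Or.inl (h2.length_eq ▸ h1)
  · exact Or.inl (h1.length_eq ▸ h2)
  · exact Or.inr (h1.trans h2)

theorem Red.append {d N : ℕ} {u v u' v' : List ℕ} (h : Red d N u v) (h' : Red d N u' v') :
    Red d N (u ++ u') (v ++ v') := by
  refine ⟨by rw [wp_append, wp_append, h.1, h'.1], ?_⟩
  rw [List.length_append, List.length_append]
  rcases h.2 with h1 | h1 <;> rcases h'.2 with h2 | h2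
  · left; omega
  · left; have := h2.length_eq; omega
  · left; have := h1.length_eq; omega
  · exact Or.inr (h1.append h2)

/-! ### Canonical words -/

/-- The parameters of the prefixes with blocks starting at the letters `0, …, m - 1`. -/
def PreData : ℕ → Type
  | 0 => Unit
  | m + 1 => PreData m × Fin (m + 2)

/-- The prefix word with given parameters. -/
def preWord : (m : ℕ) → PreData m → List ℕ
  | 0, _ => []
  | m + 1, (x, e) => preWord m x ++ dsc (m + 1) e

/-- The parameters of the empty prefix. -/
def emptyPre : (m : ℕ) → PreData m
  | 0 => ()
  | m + 1 => (emptyPre m, Fin.last _)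

theorem preWord_emptyPre (m : ℕ) : preWord m (emptyPre m) = [] := by
  induction m with
  | zero => rfl
  | succ m ih => simp [emptyPre, preWord, ih, dsc_of_le]

/-- A block of the suffix, empty if its exponent is zero. -/
def blk (N k j : ℕ) : List ℕ := if k = 0 then [] else List.replicate k N ++ dsc N j

/-- The blocks of the suffix ending at letters less than `m`, with exponents `c`. -/
def sufTo (N : ℕ) (c : ℕ → ℕ) : ℕ → List ℕ
  | 0 => []
  | m + 1 => sufTo N c m ++ blk N (c m) m

/-- The canonical word. -/
def canon (N : ℕ) (x : PreData N) (c : ℕ → ℕ) : List ℕ := preWord N x ++ sufTo N c (N + 1)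

theorem mem_preWord {m y : ℕ} {x : PreData m} (h : y ∈ preWord m x) : y < m := by
  induction m with
  | zero => simp [preWord] at h
  | succ m ih =>
    obtain ⟨x, e⟩ := x
    simp only [preWord, List.mem_append, mem_dsc] at h
    rcases h with h | h
    · exact (ih h).trans (Nat.lt_succ_self m)
    · exact h.2

theorem mem_blk {N k j y : ℕ} (h : y ∈ blk N k j) : j ≤ y ∧ y ≤ N ∨ y = N := by
  unfold blk at h
  split_ifs at h with hk
  · simp at h
  · rw [List.mem_append, mem_dsc, List.mem_replicate] at h; omega

theorem mem_sufTo {N m y : ℕ} {c : ℕ → ℕ} (h : y ∈ sufTo N c m) : y ≤ N := by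
  induction m with
  | zero => simp [sufTo] at h
  | succ m ih =>
    simp only [sufTo, List.mem_append] at h
    rcases h with h | h
    · exact ih h
    · have := mem_blk h; omega

theorem mem_canon {N y : ℕ} {x : PreData N} {c : ℕ → ℕ} (h : y ∈ canon N x c) : y ≤ N := by
  rw [canon, List.mem_append] at h
  rcases h with h | h
  · exact (mem_preWord h).le
  · exact mem_sufTo h

theorem sufTo_congr {N m : ℕ} {c c' : ℕ → ℕ} (h : ∀ j < m, c j = c' j) :
    sufTo N c m = sufTo N c' m := by
  induction m with
  | zero => rfl
  | succ m ih => rw [sufTo, sufTo, ih fun j hj => h j (by omega), h m (by omega)]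

/-! ### Right multiplication of canonical words by a generator -/

theorem br_dsc_mul {N p e b : ℕ} (hp : p ≤ N) (he : e ≤ b) (hbp : b + 1 < p) :
    Br N (dsc p e ++ [b + 1]) (b :: dsc p e) := by
  rw [← ev_brGen_eq_iff]
  simpa using ev_dsc_mul (brGen N) (brGen_commute N) (brGen_braid N) hp he hbp

theorem br_block_mul_block {N a k l : ℕ} (ha : a < N) (hk : k ≠ 0) (hl : l ≠ 0) :
    Br N (blk N k a ++ blk N l a) ((N - 1) :: (blk N l a ++ blk N k (a + 1))) := by
  obtain ⟨s, rfl⟩ : ∃ s, N = s + 1 := ⟨N - 1, by omega⟩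
  rw [← ev_brGen_eq_iff]
  simpa [blk, hk, hl, mul_assoc] using ev_block_mul_block (brGen (s + 1)) (brGen_commute (s + 1))
    (brGen_braid (s + 1)) (brGen_last s) (a := a) (by omega) (Nat.one_le_iff_ne_zero.2 hk)
    (Nat.one_le_iff_ne_zero.2 hl)

theorem red_sq (d : ℕ) {N a : ℕ} (h : a < N) : Red d N [a, a] [] :=
  ⟨by rw [wp_cons, wp_sq d h]; rfl, Or.inl (by simp)⟩

theorem br_far {N x : ℕ} {w : List ℕ} (h : ∀ y ∈ w, x + 1 < y ∨ y + 1 < x) :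
    Br N (x :: w) (w ++ [x]) := (cm_far h).br N

/-- Compare b with the end e of the last block: b prolongs the block if b + 1 = e, cancels its last
letter if b = e, and otherwise crosses it, unchanged if b + 1 < e and lowered by one if b > e, to be
absorbed by the earlier blocks. -/
theorem red_preWord_mul (d : ℕ) {N m b : ℕ} (hm : m ≤ N) (hb : b < m) (x : PreData m) :
    ∃ x', Red d N (preWord m x ++ [b]) (preWord m x') := by
  induction m generalizing b with
  | zero => omega
  | succ m ih =>
    obtain ⟨x, e, he⟩ := x
    simp only [preWord, List.append_assoc]
    rcases lt_trichotomy b e with h | rfl | h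
    · by_cases h1 : b + 1 = e
      · refine ⟨(x, ⟨b, by omega⟩), ?_⟩
        subst h1
        rw [preWord, ← dsc_snoc hb]
        exact .refl _
      · obtain ⟨x', hx'⟩ := ih (by omega) (by omega : b < m) x
        refine ⟨(x', ⟨e, he⟩), ?_⟩
        have h2 : Br N (dsc (m + 1) e ++ [b]) ([b] ++ dsc (m + 1) e) :=
          (br_far fun y hy => by rw [mem_dsc] at hy; omega).symm
        refine ((Red.refl _).append (h2.red d)).trans ?_
        rw [← List.append_assoc]
        exact hx'.append (.refl _)
    · refine ⟨(x, ⟨b + 1, by omega⟩), (Red.refl _).append ?_⟩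
      rw [dsc_snoc hb, List.append_assoc]
      simpa using (Red.refl (dsc (m + 1) (b + 1))).append (red_sq d (by omega : b < N))
    · obtain ⟨b, rfl⟩ : ∃ b', b = b' + 1 := ⟨b - 1, by omega⟩
      obtain ⟨x', hx'⟩ := ih (by omega) (by omega : b < m) x
      refine ⟨(x', ⟨e, he⟩), ?_⟩
      have h2 : Br N (dsc (m + 1) e ++ [b + 1]) ([b] ++ dsc (m + 1) e) :=
        br_dsc_mul hm (by omega) (by omega)
      refine ((Red.refl _).append (h2.red d)).trans ?_
      rw [← List.append_assoc]
      exact hx'.append (.refl _)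

/-- Every nonempty block ends below the letter that reaches it, so the letter crosses the block and
drops by one. It stays large enough for the next block because block ends are distinct. -/
theorem br_sufTo_mul {N m b : ℕ} (hmb : m ≤ b) (hb : b < N) (c : ℕ → ℕ) :
    ∃ b' < N, Br N (sufTo N c m ++ [b]) (b' :: sufTo N c m) := by
  induction m generalizing b with
  | zero => exact ⟨b, hb, .refl _⟩
  | succ m ih =>
    by_cases hc : c m = 0
    · simpa [sufTo, blk, hc] using ih (by omega) hb
    · obtain ⟨b, rfl⟩ : ∃ b', b = b' + 1 := ⟨b - 1, by omega⟩
      obtain ⟨b', hb', h⟩ := ih (by omega : m ≤ b) (by omega)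
      refine ⟨b', hb', ?_⟩
      have h1 : Br N (blk N (c m) m ++ [b + 1]) ([b] ++ blk N (c m) m) := by
        have h2 : Br N (List.replicate (c m) N ++ [b]) ([b] ++ List.replicate (c m) N) :=
          (br_far fun y hy => by rw [List.mem_replicate] at hy; omega).symm
        have h3 := (Br.refl (N := N) (List.replicate (c m) N))
        have h4 := Br.append h3 (br_dsc_mul (p := N) (e := m) le_rfl (by omega) hb)
        have h5 := Br.append h2 (Br.refl (N := N) (dsc N m))
        simp only [blk, hc, if_false]
        exact Br.trans (by simpa using h4) (by simpa using h5)
      have h6 := Br.append (Br.refl (N := N) (sufTo N c m)) h1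
      have h7 := Br.append h (Br.refl (N := N) (blk N (c m) m))
      exact Br.trans (by simpa [sufTo] using h6) (by simpa [sufTo] using h7)

/-- As in the wreath product, a transposition acts on the exponents by exchanging two neighbouring
ones. What is left over is at most one letter, which is passed on to the prefix. -/
theorem red_sufTo_mul (d : ℕ) {N a M : ℕ} (ha : a < N) (hM : a + 2 ≤ M) (hMN : M ≤ N + 1)
    (c : ℕ → ℕ) :
    ∃ w : List ℕ, (w = [] ∨ ∃ b < N, w = [b]) ∧
      Red d N (sufTo N c M ++ [a]) (w ++ sufTo N (c ∘ Equiv.swap a (a + 1)) M) := by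
  induction M, hM using Nat.le_induction with
  | base =>
    have h0 : sufTo N (c ∘ Equiv.swap a (a + 1)) a = sufTo N c a := sufTo_congr fun j hj => by
      simp [Equiv.swap_apply_of_ne_of_ne (by omega : j ≠ a) (by omega : j ≠ a + 1)]
    have push : ∀ b, a ≤ b → b < N → ∀ w v, Br N (w ++ [a]) (b :: v) → ∃ w' : List ℕ,
        (w' = [] ∨ ∃ b < N, w' = [b]) ∧
          Red d N (sufTo N c a ++ w ++ [a]) (w' ++ (sufTo N c a ++ v)) := by
      intro b hab hb w v h
      obtain ⟨b', hb', h'⟩ := br_sufTo_mul hab hb c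
      refine ⟨[b'], Or.inr ⟨b', hb', rfl⟩, ?_⟩
      have h6 := Br.append (Br.refl (N := N) (sufTo N c a)) h
      have h7 := Br.append h' (Br.refl (N := N) v)
      exact Br.red d (Br.trans (by simpa using h6) (by simpa using h7))
    simp only [sufTo, h0, Function.comp, Equiv.swap_apply_left, Equiv.swap_apply_right]
    generalize c a = k
    generalize c (a + 1) = l
    -- Without either block, a slides left through the suffix. If only the block ending at a + 1 is
    -- present, a prolongs it; if only the block ending at a is present, its last letter cancels.
    -- With both present, a makes their ends equal, and `br_block_mul_block` restores the order at
    -- the cost of a letter N - 1.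
    by_cases hk : k = 0 <;> by_cases hl : l = 0
    · simpa [blk, hk, hl] using push a le_rfl ha [] [] (.refl _)
    · refine ⟨[], Or.inl rfl, ?_⟩
      have h := dsc_snoc ha
      simp only [blk, hk, hl, h, if_true, if_false, List.nil_append, List.append_nil,
        List.append_assoc]
      exact .refl _
    · refine ⟨[], Or.inl rfl, ?_⟩
      have h := dsc_snoc ha
      simp only [blk, hk, hl, h, if_true, if_false, List.nil_append, List.append_nil,
        List.append_assoc]
      refine (Red.refl _).append ((Red.refl _).append ?_)
      simpa using (Red.refl (dsc N (a + 1))).append (red_sq d ha)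
    · have h1 := br_block_mul_block ha hk hl
      have h := dsc_snoc ha
      have h2 : blk N l (a + 1) ++ [a] = blk N l a := by
        simp [blk, hl, h]
      have := push (N - 1) (by omega) (by omega) (blk N k a ++ blk N l (a + 1)) _
        (by rw [List.append_assoc, h2]; exact h1)
      simpa using this
  | succ M hM ih =>
    obtain ⟨w, hw, h⟩ := ih (by omega)
    refine ⟨w, hw, ?_⟩
    have h1 : c (Equiv.swap a (a + 1) M) = c M := by
      rw [Equiv.swap_apply_of_ne_of_ne (by omega) (by omega)]
    have h2 : Br N (blk N (c M) M ++ [a]) ([a] ++ blk N (c M) M) :=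
      (br_far fun y hy => by have := mem_blk hy; omega).symm
    simp only [sufTo, Function.comp, h1]
    have h3 := (Red.refl (d := d) (N := N) (sufTo N c M)).append (h2.red d)
    have h4 := h.append (Red.refl (d := d) (N := N) (blk N (c M) M))
    exact Red.trans (by simpa using h3) (by simpa using h4)

/-- A letter below N permutes the exponents and may change the prefix; the letter N raises the last
exponent, which wraps to 0 on reaching d. -/
theorem red_canon_mul {d N : ℕ} (hd : 1 ≤ d) {a : ℕ} (ha : a ≤ N) (x : PreData N) (c : ℕ → ℕ)
    (hc : ∀ j, c j < d) :
    ∃ x' c', (∀ j, c' j < d) ∧ Red d N (canon N x c ++ [a]) (canon N x' c') := by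
  rcases Nat.lt_or_ge a N with h | h
  · obtain ⟨w, hw, hr⟩ := red_sufTo_mul d h (by omega : a + 2 ≤ N + 1) le_rfl c
    have h1 := (Red.refl (d := d) (N := N) (preWord N x)).append hr
    rcases hw with rfl | ⟨b, hb, rfl⟩
    · exact ⟨x, c ∘ Equiv.swap a (a + 1), fun j => hc _, by simpa [canon] using h1⟩
    · obtain ⟨x', hx'⟩ := red_preWord_mul d le_rfl hb x
      refine ⟨x', c ∘ Equiv.swap a (a + 1), fun j => hc _, ?_⟩
      have h2 := hx'.append
        (Red.refl (d := d) (N := N) (sufTo N (c ∘ Equiv.swap a (a + 1)) (N + 1)))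
      exact Red.trans (by simpa [canon] using h1) (by simpa [canon] using h2)
  · obtain rfl : a = N := le_antisymm ha h
    have h0 : ∀ k, sufTo a (Function.update c a k) a = sufTo a c a := fun k =>
      sufTo_congr fun j hj => by simp [Function.update_of_ne (by omega : j ≠ a)]
    have h1 : ∀ k, blk a k a = List.replicate k a := fun k => by
      unfold blk
      split_ifs with h
      · simp [h]
      · simp [dsc_of_le]
    have h2 : canon a x c ++ [a] = preWord a x ++ (sufTo a c a ++ List.replicate (c a + 1) a) := by
      simp [canon, sufTo, h1, List.replicate_succ']
    by_cases hk : c a + 1 < d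
    · refine ⟨x, Function.update c a (c a + 1), fun j => ?_, ?_⟩
      · by_cases hj : j = a
        · subst hj; simpa using hk
        · simpa [Function.update_of_ne hj] using hc j
      · rw [h2]
        simp only [canon, sufTo, h0, h1, Function.update_self]
        exact .refl _
    · refine ⟨x, Function.update c a 0, fun j => ?_, ?_⟩
      · by_cases hj : j = a
        · subst hj; simpa using Nat.lt_of_succ_le hd
        · simpa [Function.update_of_ne hj] using hc j
      · rw [h2]
        simp only [canon, sufTo, h0, h1, Function.update_self]
        refine (Red.refl _).append ((Red.refl _).append ⟨?_, Or.inl (by simp)⟩)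
        have := hc a
        rw [wp_replicate, (by omega : c a + 1 = d), wp_last_pow]
        rfl

theorem exists_canon {d N : ℕ} (hd : 1 ≤ d) (u : List ℕ) (hu : ∀ y ∈ u, y ≤ N) :
    ∃ x c, (∀ j, c j < d) ∧ Red d N u (canon N x c) := by
  induction u using List.reverseRecOn with
  | nil =>
    have h' : ∀ m, sufTo N (fun _ => 0) m = [] := by
      intro m
      induction m with
      | zero => rfl
      | succ m ih => simp [sufTo, ih, blk]
    exact ⟨emptyPre N, fun _ => 0, fun _ => hd, by
      rw [canon, preWord_emptyPre, h']; exact .refl _⟩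
  | append_singleton u a ih =>
    obtain ⟨x, c, hc, h⟩ := ih fun y hy => hu y (by simp [hy])
    obtain ⟨x', c', hc', h'⟩ := red_canon_mul hd (hu a (by simp)) x c hc
    exact ⟨x', c', hc', (h.append (.refl [a])).trans h'⟩

open Equiv

/-! ### The wreath product model -/

/-- The wreath product `(ℤ/d) ≀ S_{N+1}`. -/
abbrev Wreath (d n : ℕ) : Type :=
  (Fin n → Multiplicative (ZMod d)) ⋊[mulAutArrow] Perm (Fin n)

/-- The diagonal generator at `j`. -/
def diagGen (d : ℕ) {n : ℕ} (j : Fin n) : Wreath d n :=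
  SemidirectProduct.inl (Pi.mulSingle j (Multiplicative.ofAdd 1))

/-- The permutation `σ` in the wreath product. -/
def permGen (d : ℕ) {n : ℕ} (σ : Perm (Fin n)) : Wreath d n := SemidirectProduct.inr σ

theorem permGen_mul (d : ℕ) {n : ℕ} (σ τ : Perm (Fin n)) :
    permGen d (σ * τ) = permGen d σ * permGen d τ := map_mul _ _ _

theorem permGen_mul_diagGen (d : ℕ) {n : ℕ} (σ : Perm (Fin n)) (j : Fin n) :
    permGen d σ * diagGen d j = diagGen d (σ j) * permGen d σ := by
  have h : mulAutArrow σ (Pi.mulSingle j (Multiplicative.ofAdd (1 : ZMod d))) =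
      Pi.mulSingle (σ j) (Multiplicative.ofAdd (1 : ZMod d)) := by
    funext a
    show (Pi.mulSingle j (Multiplicative.ofAdd (1 : ZMod d)) : Fin n → _) (σ⁻¹ a) = _
    rw [Pi.mulSingle_apply, Pi.mulSingle_apply]
    simp only [Perm.inv_eq_iff_eq]
  have := SemidirectProduct.inl_aut (φ := mulAutArrow) σ
    (Pi.mulSingle j (Multiplicative.ofAdd (1 : ZMod d)) : Fin n → Multiplicative (ZMod d))
  rw [h] at this
  rw [diagGen, diagGen, permGen, this, mul_assoc, ← map_mul]
  simp

theorem diagGen_comm (d : ℕ) {n : ℕ} (i j : Fin n) :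
    diagGen d i * diagGen d j = diagGen d j * diagGen d i := by
  rw [diagGen, diagGen, ← map_mul, ← map_mul, mul_comm]

theorem diagGen_pow (d : ℕ) {n : ℕ} (j : Fin n) : diagGen d j ^ d = 1 := by
  rw [diagGen, ← map_pow, ← Pi.mulSingle_pow, ← ofAdd_nsmul]
  simp

/-- The images of the generators in the wreath product. -/
def wreathGen (d N : ℕ) (i : Fin (N + 1)) : Wreath d (N + 1) :=
  if h : i.val < N then permGen d (swap i ⟨i + 1, by omega⟩) else diagGen d i

theorem wreathGen_relators (d N : ℕ) :
    ∀ r ∈ relators d (N + 1), FreeGroup.lift (wreathGen d N) r = 1 := by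
  rintro r ((((⟨i, hi, rfl⟩ | ⟨i, hi, rfl⟩) | ⟨i, j, hij, rfl⟩) | ⟨i, j, hij, hj, rfl⟩) |
    ⟨i, j, hij, hj, rfl⟩)
  · rw [map_pow, FreeGroup.lift_apply_of, wreathGen, dif_neg (by omega), diagGen_pow]
  · rw [map_pow, FreeGroup.lift_apply_of, wreathGen, dif_pos (by omega), pow_two, ← permGen_mul,
      swap_mul_self]
    exact map_one _
  · have hi := i.2
    rw [map_mul, map_inv, mul_inv_eq_one, map_mul, map_mul, FreeGroup.lift_apply_of,
      FreeGroup.lift_apply_of, wreathGen, wreathGen, dif_pos (by omega : j.val < N)]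
    split_ifs with h
    · rw [← permGen_mul, ← permGen_mul]
      congr 1
      refine (Perm.Disjoint.commute ?_).eq
      intro x
      by_cases hx : x = i ∨ x = ⟨i + 1, by omega⟩
      · right
        refine swap_apply_of_ne_of_ne ?_ ?_ <;> rcases hx with rfl | rfl <;>
          simp only [ne_eq, Fin.ext_iff] <;> omega
      · left
        exact swap_apply_of_ne_of_ne (fun h => hx (Or.inl h)) (fun h => hx (Or.inr h))
    · rw [permGen_mul_diagGen, swap_apply_of_ne_of_ne] <;> simp only [ne_eq, Fin.ext_iff] <;> omega
  · rw [map_mul, map_inv, mul_inv_eq_one]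
    simp only [map_mul, FreeGroup.lift_apply_of]
    rw [wreathGen, wreathGen, dif_pos (by omega), dif_pos (by omega)]
    simp only [← permGen_mul]
    have h1 : (⟨i + 1, by omega⟩ : Fin (N + 1)) = j := Fin.ext hij.symm
    rw [h1]
    congr 1
    generalize hk : (⟨j + 1, by omega⟩ : Fin (N + 1)) = k
    have hij' : i ≠ j := by rw [ne_eq, Fin.ext_iff]; omega
    have hjk : j ≠ k := by rw [← hk, ne_eq, Fin.ext_iff]; simp
    have hik : i ≠ k := by rw [← hk, ne_eq, Fin.ext_iff]; simp; omega
    have e1 : swap j k * swap i j * swap j k = swap i k := by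
      have := swap_mul_swap_mul_swap hij' hik
      rw [swap_comm j k] at this ⊢
      rw [this, swap_comm]
    have e2 : swap i j * swap j k * swap i j = swap i k := by
      have := swap_mul_swap_mul_swap (x := k) (y := j) (z := i) hjk.symm hik.symm
      rw [swap_comm j i, swap_comm k j] at this
      exact this
    rw [e1, e2]
  · rw [map_mul, map_inv, mul_inv_eq_one]
    simp only [map_mul, FreeGroup.lift_apply_of]
    rw [wreathGen, wreathGen, dif_pos (by omega : i.val < N), dif_neg (by omega : ¬ j.val < N)]
    have h1 : (⟨i + 1, by omega⟩ : Fin (N + 1)) = j := Fin.ext hij.symm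
    rw [h1]
    have hss : permGen d (swap i j) * permGen d (swap i j) = 1 := by
      rw [← permGen_mul, swap_mul_self]; exact map_one _
    have hst : permGen d (swap i j) * diagGen d j = diagGen d i * permGen d (swap i j) := by
      rw [permGen_mul_diagGen, swap_apply_right]
    rw [mul_assoc (diagGen d j), hst, ← mul_assoc (diagGen d j),
      mul_assoc _ (permGen d _) (permGen d _),
      mul_assoc _ (permGen d _) (permGen d _), hss, mul_one, mul_one, diagGen_comm]

/-- The homomorphism from `G(d,1,N+1)` to the wreath product. -/
def toWreath (d N : ℕ) : G d (N + 1) →* Wreath d (N + 1) :=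
  PresentedGroup.toGroup (wreathGen_relators d N)

/-- Adjacent transpositions generate all permutations, and conjugating the last diagonal generator
by permutations yields the others, whose powers give all diagonal elements. -/
theorem toWreath_surjective {d : ℕ} (hd : 1 ≤ d) (N : ℕ) : Function.Surjective (toWreath d N) := by
  have : NeZero d := ⟨by omega⟩
  rw [← MonoidHom.range_eq_top, eq_top_iff]
  have hgen : ∀ i, wreathGen d N i ∈ (toWreath d N).range := fun i =>
    ⟨PresentedGroup.of i, PresentedGroup.toGroup.of _⟩
  have hperm : ∀ σ, permGen d σ ∈ (toWreath d N).range := by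
    intro σ
    have hσ : σ ∈ Submonoid.closure (Set.range fun i : Fin N => swap i.castSucc i.succ) := by
      rw [Perm.mclosure_swap_castSucc_succ]; trivial
    induction hσ using Submonoid.closure_induction with
    | mem x hx =>
      obtain ⟨i, rfl⟩ := hx
      have := hgen i.castSucc
      rw [wreathGen, dif_pos (by simp)] at this
      exact this
    | one => exact one_mem _
    | mul x y _ _ hx hy => rw [permGen_mul]; exact mul_mem hx hy
  have hdiag : ∀ j, diagGen d j ∈ (toWreath d N).range := by
    intro j
    have h1 := hgen (Fin.last N)
    rw [wreathGen, dif_neg (by simp)] at h1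
    have h2 := permGen_mul_diagGen d (swap (Fin.last N) j) (Fin.last N)
    rw [swap_apply_left, ← mul_inv_eq_iff_eq_mul] at h2
    rw [← h2]
    exact mul_mem (mul_mem (hperm _) h1) (inv_mem (hperm _))
  rintro ⟨f, σ⟩ -
  rw [SemidirectProduct.mk_eq_inl_mul_inr]
  refine mul_mem ?_ (hperm σ)
  have : f ∈ (toWreath d N).range.comap SemidirectProduct.inl := by
    rw [← Finset.univ_prod_mulSingle f]
    refine Subgroup.prod_mem _ fun j _ => ?_
    have h3 : f j = Multiplicative.ofAdd (1 : ZMod d) ^ (Multiplicative.toAdd (f j)).val := by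
      rw [← ofAdd_nsmul]
      simp
    rw [h3, Pi.mulSingle_pow]
    exact pow_mem (Subgroup.mem_comap.2 (hdiag j)) _
  exact this

/-! ### Canonical words as normal forms -/

instance fintypePreData : (m : ℕ) → Fintype (PreData m)
  | 0 => inferInstanceAs (Fintype Unit)
  | m + 1 => have := fintypePreData m; inferInstanceAs (Fintype (PreData m × Fin (m + 2)))

theorem card_preData (m : ℕ) : Fintype.card (PreData m) = (m + 1).factorial := by
  induction m with
  | zero => rfl
  | succ m ih =>
    have : Fintype.card (PreData (m + 1)) = Fintype.card (PreData m × Fin (m + 2)) := rfl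
    rw [this, Fintype.card_prod, ih, Fintype.card_fin, Nat.factorial_succ (m + 1), mul_comm]

/-- Extension by zero of the exponents to all of `ℕ`. -/
def col {d n : ℕ} (c : Fin n → Fin d) (j : ℕ) : ℕ := if h : j < n then c ⟨j, h⟩ else 0

/-- The parameters of canonical words. -/
abbrev CanonData (d N : ℕ) : Type := PreData N × (Fin (N + 1) → Fin d)

/-- The canonical word with given parameters. -/
def canonWord {d N : ℕ} (p : CanonData d N) : List ℕ := canon N p.1 (col p.2)

theorem exists_canonWord {d N : ℕ} (hd : 1 ≤ d) (u : List ℕ) (hu : ∀ y ∈ u, y ≤ N) :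
    ∃ p : CanonData d N, Red d N u (canonWord p) := by
  obtain ⟨x, c, hc, h⟩ := exists_canon hd u hu
  refine ⟨(x, fun j => ⟨c j, hc j⟩), ?_⟩
  have : canonWord (d := d) (N := N) (x, fun j => ⟨c j, hc j⟩) = canon N x c := by
    rw [canonWord, canon, canon]
    congr 1
    exact sufTo_congr fun j hj => by simp [col, hj]
  rwa [this]

theorem wordProd_surjective (d : ℕ) {n : ℕ} (hd : 1 ≤ d) (hn : 1 ≤ n) (w : G d n) :
    ∃ u, wordProd d n u = w := by
  have hinv : ∀ i : Fin n, ∃ u, wordProd d n u = (PresentedGroup.of i : G d n)⁻¹ := by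
    intro i
    obtain ⟨N, rfl⟩ : ∃ N, n = N + 1 := ⟨n - 1, by omega⟩
    by_cases h : i.val < N
    · refine ⟨[i], ?_⟩
      have h1 := wp_sq d h
      rw [wp_singleton d i.2] at h1
      rw [eq_inv_iff_mul_eq_one]
      simpa [wordProd] using h1
    · refine ⟨List.replicate (d - 1) i, ?_⟩
      have h1 := wp_last_pow d N
      rw [wp_singleton d (Nat.lt_succ_self N)] at h1
      have hi : i = ⟨N, Nat.lt_succ_self N⟩ := Fin.ext (by simp; omega)
      rw [← hi] at h1
      rw [eq_inv_iff_mul_eq_one]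
      simp only [wordProd, List.map_replicate, List.prod_replicate]
      rw [← pow_succ, Nat.sub_add_cancel hd, h1]
  have hw : w ∈ Subgroup.closure (Set.range (PresentedGroup.of : Fin n → G d n)) := by
    rw [PresentedGroup.closure_range_of]; trivial
  induction hw using Subgroup.closure_induction'' with
  | one => exact ⟨[], rfl⟩
  | mem x hx =>
    obtain ⟨i, rfl⟩ := hx
    exact ⟨[i], by simp [wordProd]⟩
  | inv_mem x hx =>
    obtain ⟨i, rfl⟩ := hx
    exact hinv i
  | mul x y _ _ hx hy =>
    obtain ⟨u, rfl⟩ := hx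
    obtain ⟨v, rfl⟩ := hy
    exact ⟨u ++ v, wordProd_append d n u v⟩

theorem wp_canonWord_surjective {d : ℕ} (hd : 1 ≤ d) (N : ℕ) :
    Function.Surjective fun p : CanonData d N => wp d N (canonWord p) := by
  intro w
  obtain ⟨u, rfl⟩ := wordProd_surjective d hd (Nat.succ_pos N) w
  obtain ⟨p, hp⟩ := exists_canonWord (d := d) (N := N) hd (u.map Fin.val) fun y hy => by
    obtain ⟨i, -, rfl⟩ := List.mem_map.1 hy
    omega
  exact ⟨p, by rw [← wp_map_val, hp.1]⟩

/-- The composite with the map to the wreath product is a surjection between finite sets of equal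
size, hence injective. No upper bound on the order of the presented group is needed beforehand. -/
theorem wp_canonWord_injective {d : ℕ} (hd : 1 ≤ d) (N : ℕ) :
    Function.Injective fun p : CanonData d N => wp d N (canonWord p) := by
  have : NeZero d := ⟨by omega⟩
  have h1 : Function.Surjective fun p : CanonData d N => toWreath d N (wp d N (canonWord p)) :=
    (toWreath_surjective hd N).comp (wp_canonWord_surjective hd N)
  have h2 : Nat.card (CanonData d N) = Nat.card (Wreath d (N + 1)) := by
    rw [SemidirectProduct.card, Nat.card_prod, Nat.card_eq_fintype_card, card_preData,
      Nat.card_perm, Nat.card_fun, Nat.card_fun, mul_comm]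
    simp
  have h3 := h1.bijective_of_nat_card_le h2.le
  exact fun p q h => h3.1 (congrArg (toWreath d N) h)

/-- Reduced words of the element expressed by a canonical word. -/
theorem mem_reducedWords_iff {d N : ℕ} (hd : 1 ≤ d) (p : CanonData d N) (u : List (Fin (N + 1))) :
    u ∈ reducedWords d (N + 1) (wp d N (canonWord p)) ↔ Br N (u.map Fin.val) (canonWord p) := by
  -- Any word for the element rewrites to some canonical word, which uniqueness identifies with the
  -- given one. So every such word is longer than the canonical word or braid equivalent to it.
  have key : ∀ v : List (Fin (N + 1)), wordProd d (N + 1) v = wp d N (canonWord p) →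
      Red d N (v.map Fin.val) (canonWord p) := by
    intro v hv
    obtain ⟨q, hq⟩ := exists_canonWord (d := d) (N := N) hd (v.map Fin.val) fun y hy => by
      obtain ⟨i, -, rfl⟩ := List.mem_map.1 hy
      omega
    have : q = p := wp_canonWord_injective hd N (by
      show wp d N (canonWord q) = wp d N (canonWord p)
      rw [← hq.1, wp_map_val, hv])
    rwa [this] at hq
  have hlen : (lift N (canonWord p)).length = (canonWord p).length := by
    conv_rhs => rw [← map_val_lift (N := N) (u := canonWord p) fun y hy => mem_canon hy]
    simp
  constructor
  · rintro ⟨hu, hmin⟩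
    rcases (key u hu).2 with h | h
    · have := hmin (lift N (canonWord p)) rfl
      rw [hlen] at this
      rw [List.length_map] at h
      omega
    · exact h
  · intro h
    refine ⟨by rw [← wp_map_val, h.wp_eq d], fun v hv => ?_⟩
    have h1 := h.length_eq
    rw [List.length_map] at h1
    have h2 := (key v hv).2
    rw [h1]
    rcases h2 with h2 | h2
    · rw [List.length_map] at h2
      omega
    · have := h2.length_eq
      rw [List.length_map] at this
      omega

/-! ### Full commutativity of canonical words -/

theorem BraidRel.mem_iff {N y : ℕ} {l r : List ℕ} (h : BraidRel N l r) : y ∈ l ↔ y ∈ r := by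
  cases h with
  | braid i h => simp; tauto
  | last s a b h ha hb => simp; tauto

theorem Br.mem_iff {N y : ℕ} {u v : List ℕ} (h : Br N u v) : y ∈ u ↔ y ∈ v := by
  induction h with
  | rel u v huv =>
    rcases huv with ⟨a, b, x, y, hxy, rfl, rfl⟩ | ⟨a, b, l, r, hlr, rfl, rfl⟩
    · simp; tauto
    · simp [hlr.mem_iff]
  | refl u => rfl
  | symm u v _ ih => exact ih.symm
  | trans u v w _ _ ih1 ih2 => exact ih1.trans ih2

/-- An allowed interchange never involves both i and i + 1, so the subword on these two letters is
an invariant of the commutation class. -/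
theorem Cm.filter_eq {u v : List ℕ} (h : Cm u v) (i : ℕ) :
    u.filter (fun y => y = i ∨ y = i + 1) = v.filter (fun y => y = i ∨ y = i + 1) := by
  induction h with
  | rel u v huv =>
    obtain ⟨a, b, x, y, hxy, rfl, rfl⟩ := huv
    by_cases hx : x = i ∨ x = i + 1
    · have hy : ¬ (y = i ∨ y = i + 1) := by omega
      simp [List.filter_append, hx, hy]
    · simp [List.filter_append, List.filter_cons, hx]
  | refl u => rfl
  | symm u v _ ih => exact ih.symm
  | trans u v w _ _ ih1 ih2 => exact ih1.trans ih2

theorem BraidRel.not_cm {N : ℕ} {l r : List ℕ} (h : BraidRel N l r) (a b : List ℕ) :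
    ¬ Cm (a ++ l ++ b) (a ++ r ++ b) := by
  intro hcm
  cases h with
  | braid i h =>
    have := hcm.filter_eq i
    simp [List.filter_append] at this
  | last s k l h hk hl =>
    have := hcm.filter_eq s
    subst h
    obtain ⟨k, rfl⟩ : ∃ k', k = k' + 1 := ⟨k - 1, by omega⟩
    simp [List.filter_append, List.replicate_succ] at this

/-- No braid move is available at any word of the commutation class of the canonical word, so that
class is already the whole braid class. -/
theorem isFullyCommutative_of_forall {d N : ℕ} (hd : 1 ≤ d) (p : CanonData d N)
    (h : ∀ a b l r, BraidRel N l r → ¬ Cm (canonWord p) (a ++ l ++ b) ∧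
      ¬ Cm (canonWord p) (a ++ r ++ b)) :
    IsFullyCommutative d (N + 1) (wp d N (canonWord p)) := by
  have key : ∀ {u v}, Br N u v → (Cm (canonWord p) u ↔ Cm (canonWord p) v) := by
    intro u v huv
    induction huv with
    | rel u v huv =>
      rcases huv with huv | ⟨a, b, l, r, hlr, rfl, rfl⟩
      · exact ⟨fun h => h.trans _ _ _ (.rel _ _ huv),
          fun h => h.trans _ _ _ (.symm _ _ (.rel _ _ huv))⟩
      · exact iff_of_false (h a b l r hlr).1 (h a b l r hlr).2
    | refl u => rfl
    | symm u v _ ih => exact ih.symm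
    | trans u v w _ _ ih1 ih2 => exact ih1.trans ih2
  intro u hu v hv
  rw [mem_reducedWords_iff hd] at hu hv
  have hu' := (key hu).2 (.refl _)
  have hv' := (key hv).2 (.refl _)
  have := commEquiv_lift N (hu'.symm.trans _ _ _ hv')
  rwa [lift_map_val, lift_map_val] at this

/-- Applying the braid move gives a second reduced word, outside the commutation class by
`BraidRel.not_cm`. -/
theorem not_isFullyCommutative_of_cm {d N : ℕ} (hd : 1 ≤ d) (p : CanonData d N)
    {a b l r : List ℕ} (hlr : BraidRel N l r ∨ BraidRel N r l)
    (h : Cm (canonWord p) (a ++ l ++ b)) :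
    ¬ IsFullyCommutative d (N + 1) (wp d N (canonWord p)) := by
  intro hfc
  have h1 : Br N (canonWord p) (a ++ l ++ b) := h.br N
  have hlr' : Br N l r := by
    rcases hlr with hlr | hlr
    · exact hlr.br
    · exact hlr.br.symm
  have h2 : Br N (canonWord p) (a ++ r ++ b) :=
    h1.trans (((Br.refl a).append hlr').append (Br.refl b))
  have e1 := map_val_lift (N := N) (u := a ++ l ++ b) fun y hy => mem_canon (h1.mem_iff.2 hy)
  have e2 := map_val_lift (N := N) (u := a ++ r ++ b) fun y hy => mem_canon (h2.mem_iff.2 hy)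
  have h3 := hfc (lift N (a ++ l ++ b))
    ((mem_reducedWords_iff hd p _).2 (by rw [e1]; exact h1.symm))
    (lift N (a ++ r ++ b)) ((mem_reducedWords_iff hd p _).2 (by rw [e2]; exact h2.symm))
  have h4 := commEquiv_map_val N h3
  rw [e1, e2] at h4
  rcases hlr with hlr | hlr
  · exact hlr.not_cm a b h4
  · exact hlr.not_cm a b h4.symm

/-! ### Admissible parameters -/

/-- The nonempty blocks of the prefix end at strictly increasing letters, all less than `k`. -/
def Good : (m : ℕ) → ℕ → PreData m → Prop
  | 0, _, _ => True
  | m + 1, k, (x, e) => (e.val = m + 1 ∧ Good m k x) ∨ (e.val ≤ m ∧ e.val < k ∧ Good m e x)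

/-- The prefix is of the form `u s_p s_{p+1} ⋯ s_m` with `p ≥ k` (where the ascending part may be
empty), and `u` satisfies `Good` with bound `k`. -/
def GoodAsc : (m : ℕ) → ℕ → PreData m → Prop
  | 0, _, _ => True
  | m + 1, k, (x, e) => Good (m + 1) k (x, e) ∨ (e.val = m ∧ k ≤ m ∧ GoodAsc m k x)

/-- The condition on the parameters equivalent to full commutativity. -/
def IsGood (N : ℕ) (x : PreData N) (c : ℕ → ℕ) : Prop :=
  ((∀ i ≤ N, c i = 0) ∧ Good N N x) ∨
    ∃ j ≤ N, c j ≠ 0 ∧ (∀ i < j, c i = 0) ∧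
      (((∀ i, j < i → i ≤ N → c i = 0) ∧ GoodAsc N j x) ∨
        ((∃ i, j < i ∧ i ≤ N ∧ c i ≠ 0) ∧ Good N j x))

theorem good_goodAsc {m k : ℕ} {x : PreData m} (h : Good m k x) : GoodAsc m k x := by
  cases m with
  | zero => trivial
  | succ m => exact Or.inl h

/-! ### Automata invariant under commutations -/

section Automaton

variable {σ : Type*} {δ : Option σ → ℕ → Option σ}

theorem foldl_eq_of_cm (hδ : ∀ t x y, y + 1 < x → δ (δ t x) y = δ (δ t y) x) {u v : List ℕ}
    (h : Cm u v) (t : Option σ) : u.foldl δ t = v.foldl δ t := by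
  induction h with
  | rel u v huv =>
    obtain ⟨a, b, x, y, hxy, rfl, rfl⟩ := huv
    simp [hδ _ x y hxy]
  | refl u => rfl
  | symm u v _ ih => exact ih.symm
  | trans u v w _ _ ih1 ih2 => exact ih1.trans ih2

theorem foldl_none (hn : ∀ y, δ none y = none) (u : List ℕ) : u.foldl δ none = none := by
  induction u with
  | nil => rfl
  | cons a u ih => rw [List.foldl_cons, hn, ih]

/-- The final state is constant on commutation classes and failure is permanent, so acceptance of
one word excludes the factor l from every equivalent word. -/
theorem not_cm_of_foldl (hδ : ∀ t x y, y + 1 < x → δ (δ t x) y = δ (δ t y) x)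
    (hn : ∀ y, δ none y = none) {u l : List ℕ} {t : Option σ} {t' : σ} (h : u.foldl δ t = some t')
    (hl : ∀ t, l.foldl δ t = none) (a b : List ℕ) : ¬ Cm u (a ++ l ++ b) := by
  intro hcm
  have := foldl_eq_of_cm hδ hcm t
  rw [h, List.foldl_append, List.foldl_append, hl, foldl_none hn] at this
  exact absurd this (by simp)

end Automaton

/-- The automaton counting the letters `i ± 1` read since the last `i`, which fails if there are
fewer than two of them when the next `i` is read. -/
def innerStep (i : ℕ) : Option ℕ → ℕ → Option ℕ
  | none, _ => none
  | some c, y => if y = i then if 2 ≤ c then some 0 else none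
      else if y = i + 1 ∨ y + 1 = i then some (c + 1) else some c

/-- Among letters that commute, only i - 1 and i + 1 can both change the state, and they both just
increment the counter. -/
theorem innerStep_comm (i : ℕ) (t : Option ℕ) (x y : ℕ) (h : y + 1 < x) :
    innerStep i (innerStep i t x) y = innerStep i (innerStep i t y) x := by
  cases t with
  | none => rfl
  | some c =>
    simp only [innerStep]
    split_ifs <;> first | omega | (simp only; split_ifs; all_goals first | omega | rfl)

theorem innerStep_of_notMem {i : ℕ} {w : List ℕ} (hw : i ∉ w) (c : ℕ) :
    ∃ c', w.foldl (innerStep i) (some c) = some c' ∧ c ≤ c' ∧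
      ((∃ y ∈ w, y = i + 1 ∨ y + 1 = i) → c + 1 ≤ c') := by
  induction w generalizing c with
  | nil => exact ⟨c, rfl, le_rfl, by simp⟩
  | cons a w ih =>
    rw [List.mem_cons, not_or] at hw
    rw [List.foldl_cons]
    simp only [innerStep, if_neg (Ne.symm hw.1)]
    split_ifs with h
    · obtain ⟨c', h1, h2, -⟩ := ih hw.2 (c + 1)
      exact ⟨c', h1, by omega, fun _ => h2⟩
    · obtain ⟨c', h1, h2, h3⟩ := ih hw.2 c
      refine ⟨c', h1, h2, ?_⟩
      rintro ⟨y, hy, hy'⟩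
      rcases List.mem_cons.1 hy with rfl | hy
      · exact absurd hy' h
      · exact h3 ⟨y, hy, hy'⟩

/-- If the run starts above i it supplies a neighbour i + 1 just before i, so one earlier neighbour
suffices; if it continues below i, the neighbour i - 1 follows. -/
theorem innerStep_dsc {i p e c : ℕ} (he : e ≤ i) (hp : i < p) (hc : 2 ≤ c ∨ (1 ≤ c ∧ i + 1 < p)) :
    ∃ c', (dsc p e).foldl (innerStep i) (some c) = some c' ∧ (e < i → 1 ≤ c') := by
  rw [dsc_append (q := i + 1) (by omega) (by omega), dsc_succ he, List.foldl_append,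
    List.foldl_cons]
  obtain ⟨c1, h1, h2, h3⟩ := innerStep_of_notMem (i := i) (w := dsc p (i + 1))
    (by rw [mem_dsc]; omega) c
  have h4 : 2 ≤ c1 := by
    rcases hc with hc | ⟨hc, hp'⟩
    · omega
    · have := h3 ⟨i + 1, by rw [mem_dsc]; omega, Or.inl rfl⟩
      omega
  obtain ⟨c2, h5, -, h6⟩ := innerStep_of_notMem (i := i) (w := dsc i e) (by rw [mem_dsc]; omega) 0
  refine ⟨c2, ?_, fun h => ?_⟩
  · rw [h1]
    simpa [innerStep, h4] using h5
  · exact h6 ⟨i - 1, by rw [mem_dsc]; omega, by omega⟩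

/-- The counter starts at 2 so that the first i is always accepted. Since ends increase and stay
below k ≤ i, each block containing i continues to i - 1, leaving a neighbour in stock for the next
i. -/
theorem innerStep_preWord {i m k : ℕ} {x : PreData m} (h : Good m k x) :
    ∃ c, (preWord m x).foldl (innerStep i) (some 2) = some c ∧ (m ≤ i → 2 ≤ c) ∧
      (k ≤ i → 1 ≤ c) := by
  induction m generalizing k with
  | zero => exact ⟨2, rfl, fun _ => le_rfl, fun _ => by omega⟩
  | succ m ih =>
    obtain ⟨x, e, he⟩ := x
    simp only [preWord, List.foldl_append]
    rcases h with ⟨h, hx⟩ | ⟨h, hk, hx⟩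
    · obtain ⟨c, h1, h2, h3⟩ := ih hx
      simp only at h
      refine ⟨c, ?_, fun hm => h2 (by omega), h3⟩
      rw [h1, h, dsc_of_le le_rfl]
      rfl
    · obtain ⟨c, h1, h2, h3⟩ := ih hx
      simp only at h hk h3
      rw [h1]
      by_cases hi : e ≤ i ∧ i < m + 1
      · obtain ⟨c', h4, h5⟩ := innerStep_dsc (c := c) hi.1 hi.2 (by
          rcases Nat.lt_or_ge i m with hm | hm
          · exact Or.inr ⟨h3 hi.1, by omega⟩
          · exact Or.inl (h2 hm))
        exact ⟨c', h4, fun hm => by omega, fun hm => h5 (by omega)⟩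
      · obtain ⟨c', h4, h5, -⟩ := innerStep_of_notMem (i := i) (w := dsc (m + 1) e)
          (by rw [mem_dsc]; omega) c
        exact ⟨c', h4, fun hm => (h2 (by omega)).trans h5, fun hm => (h3 (by omega)).trans h5⟩

/-- In the ascending tail the letter i is followed by i + 1 unless i = m - 1 is the very last
letter; this is the only exception to the bound. -/
theorem innerStep_preWord_asc {i m k : ℕ} {x : PreData m} (h : GoodAsc m k x) :
    ∃ c, (preWord m x).foldl (innerStep i) (some 2) = some c ∧ (m ≤ i → 2 ≤ c) ∧
      (k ≤ i → m ≠ i + 1 → 1 ≤ c) := by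
  induction m with
  | zero => exact ⟨2, rfl, fun _ => le_rfl, fun _ _ => by omega⟩
  | succ m ih =>
    obtain ⟨x, e, he⟩ := x
    rcases h with h | ⟨h, hk, hx⟩
    · obtain ⟨c, h1, h2, h3⟩ := innerStep_preWord (i := i) h
      exact ⟨c, h1, h2, fun h4 _ => h3 h4⟩
    · simp only at h
      subst h
      obtain ⟨c, h1, h2, h3⟩ := ih hx
      have h4 : dsc (e + 1) e = [e] := by rw [dsc_succ le_rfl, dsc_of_le le_rfl]
      simp only [preWord, List.foldl_append, h1, h4, List.foldl_cons, List.foldl_nil, innerStep]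
      split_ifs with h5 h6 h7
      · exact ⟨0, rfl, by omega, by omega⟩
      · exact absurd (h2 h5.le) h6
      · exact ⟨c + 1, rfl, fun h => by have := h2 (by omega); omega, by omega⟩
      · exact ⟨c, rfl, fun h => h2 (by omega), fun h8 _ => h3 h8 (by omega)⟩

/-- A block ending at j ≤ i passes through i + 1 before i. The second neighbour comes from the
prefix for the first such block, and afterwards from the letter i - 1 of the previous one. -/
theorem innerStep_sufTo {i N m c₀ : ℕ} (hi : i + 1 < N) (c : ℕ → ℕ)
    (h : (∃ j ≤ i, j < m ∧ c j ≠ 0) → 1 ≤ c₀) :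
    ∃ c', (sufTo N c m).foldl (innerStep i) (some c₀) = some c' ∧ (m ≤ i → 1 ≤ c₀ → 1 ≤ c') := by
  induction m with
  | zero => exact ⟨c₀, rfl, fun _ h => h⟩
  | succ m ih =>
    obtain ⟨c', h1, h2⟩ := ih fun ⟨j, hj, hjm, hc⟩ => h ⟨j, hj, by omega, hc⟩
    simp only [sufTo, List.foldl_append, h1]
    unfold blk
    split_ifs with hc
    · exact ⟨c', rfl, fun hm => h2 (by omega)⟩
    · rw [List.foldl_append]
      have h3 : (List.replicate (c m) N).foldl (innerStep i) (some c') = some c' := by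
        generalize c m = k
        induction k with
        | zero => rfl
        | succ k ih =>
          rw [List.replicate_succ, List.foldl_cons]
          simp only [innerStep]
          rw [if_neg (by omega), if_neg (by omega), ih]
      rw [h3]
      by_cases hm : m ≤ i
      · have := h ⟨m, hm, by omega, hc⟩
        obtain ⟨c2, h4, h5⟩ := innerStep_dsc (i := i) (p := N) (c := c') hm (by omega)
          (Or.inr ⟨h2 hm this, hi⟩)
        exact ⟨c2, h4, fun hm' _ => h5 (by omega)⟩
      · obtain ⟨c2, h4, -⟩ := innerStep_of_notMem (i := i) (w := dsc N m)
          (by rw [mem_dsc]; omega) c'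
        exact ⟨c2, h4, fun hm' => by omega⟩

/-- The state of `lastStep`: the number of `s - 1` since the last `s`, whether an `s + 1` occurred
since the last `s`, whether one occurred before the last `s`, and whether no further `s + 1` is
allowed. -/
abbrev LastState : Type := ℕ × Bool × Bool × Bool

/-- The automaton for the last generator `s + 1` and its neighbour `s`. -/
def lastStep (s : ℕ) : Option LastState → ℕ → Option LastState
  | none, _ => none
  | some (c, h, t, f), y =>
    if y = s + 1 then if f then none else some (c, true, t, f)
    else if y = s then
      if 2 ≤ c ∨ (1 ≤ c ∧ h = true) then some (0, false, t || h, f)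
      else if c = 0 ∧ h = true ∧ t = false ∧ f = false then some (0, false, true, true)
      else none
    else if y + 1 = s then some (c + 1, h, t, f) else some (c, h, t, f)

/-- The letters s - 1 and s + 1 alter different components of the state, and the decision to reject
s + 1 depends only on the lock, which s - 1 leaves unchanged. -/
theorem lastStep_comm (s : ℕ) (t : Option LastState) (x y : ℕ) (h : y + 1 < x) :
    lastStep s (lastStep s t x) y = lastStep s (lastStep s t y) x := by
  rcases t with _ | ⟨c, h, t, f⟩
  · rfl
  · simp only [lastStep]
    split_ifs <;> first | omega | (simp only; split_ifs; all_goals first | omega | rfl)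

theorem lastStep_of_notMem {s : ℕ} {w : List ℕ} (hw : ∀ y ∈ w, y < s) (c : ℕ) (h t f : Bool) :
    ∃ c', w.foldl (lastStep s) (some (c, h, t, f)) = some (c', h, t, f) ∧ c ≤ c' ∧
      ((∃ y ∈ w, y + 1 = s) → c + 1 ≤ c') := by
  induction w generalizing c with
  | nil => exact ⟨c, rfl, le_rfl, by simp⟩
  | cons a w ih =>
    have ha := hw a (by simp)
    have hw' : ∀ y ∈ w, y < s := fun y hy => hw y (by simp [hy])
    rw [List.foldl_cons]
    simp only [lastStep, if_neg (by omega : ¬ a = s + 1), if_neg (by omega : ¬ a = s)]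
    split_ifs with h0
    · obtain ⟨c', h1, h2, -⟩ := ih hw' (c + 1)
      exact ⟨c', h1, by omega, fun _ => h2⟩
    · obtain ⟨c', h1, h2, h3⟩ := ih hw' c
      refine ⟨c', h1, h2, ?_⟩
      rintro ⟨y, hy, hy'⟩
      rcases List.mem_cons.1 hy with rfl | hy
      · exact absurd hy' h0
      · exact h3 ⟨y, hy, hy'⟩

theorem lastStep_replicate {s k : ℕ} (hk : k ≠ 0) (c : ℕ) (h t : Bool) :
    (List.replicate k (s + 1)).foldl (lastStep s) (some (c, h, t, false)) =
      some (c, true, t, false) := by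
  obtain ⟨k, rfl⟩ : ∃ k', k = k' + 1 := ⟨k - 1, by omega⟩
  induction k generalizing h with
  | zero => simp [lastStep]
  | succ k ih =>
    rw [List.replicate_succ, List.foldl_cons]
    simp only [lastStep, if_true]
    exact ih true (by omega)

theorem lastStep_dsc {s e c : ℕ} (he : e ≤ s) (h t : Bool) (hc : 2 ≤ c ∨ (1 ≤ c ∧ h = true)) :
    ∃ c', (dsc (s + 1) e).foldl (lastStep s) (some (c, h, t, false)) =
      some (c', false, t || h, false) ∧ (e < s → 1 ≤ c') := by
  obtain ⟨c', h1, -, h2⟩ := lastStep_of_notMem (s := s) (w := dsc s e)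
    (fun y hy => (mem_dsc.1 hy).2) 0 false (t || h) false
  refine ⟨c', ?_, fun h => h2 ⟨s - 1, by rw [mem_dsc]; omega, by omega⟩⟩
  rw [dsc_succ he, List.foldl_cons, ← h1]
  simp only [lastStep]
  rw [if_neg (by omega), if_pos trivial, if_pos hc]

/-- A good prefix contains s at most once, as the first letter of its last block, so the counter is
still at least 2 there. If k ≤ s, that block continues to s - 1. -/
theorem lastStep_preWord {s k : ℕ} {x : PreData (s + 1)} (h : Good (s + 1) k x) :
    ∃ c, (preWord (s + 1) x).foldl (lastStep s) (some (2, false, false, false)) =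
      some (c, false, false, false) ∧ (k ≤ s → 1 ≤ c) := by
  obtain ⟨x, e, he⟩ := x
  obtain ⟨c, h1, h2, -⟩ := lastStep_of_notMem (s := s) (w := preWord s x)
    (fun y hy => mem_preWord hy) 2 false false false
  simp only [preWord, List.foldl_append, h1]
  rcases h with ⟨h, hx⟩ | ⟨h, hk, hx⟩
  · refine ⟨c, ?_, by omega⟩
    simp only at h
    rw [h, dsc_of_le le_rfl]
    rfl
  · obtain ⟨c', h3, h4⟩ := lastStep_dsc (c := c) h false false (Or.inl h2)
    exact ⟨c', h3, fun h5 => h4 (by simp only at hk ⊢; omega)⟩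

theorem lastStep_sufTo {s m c₀ : ℕ} (c : ℕ → ℕ) (hm : m ≤ s + 2)
    (h : (∃ j ≤ s, j < m ∧ c j ≠ 0) → 1 ≤ c₀) :
    ∃ c' h' t', (sufTo (s + 1) c m).foldl (lastStep s) (some (c₀, false, false, false)) =
      some (c', h', t', false) ∧ (m ≤ s → 1 ≤ c₀ → 1 ≤ c') := by
  induction m with
  | zero => exact ⟨c₀, false, false, rfl, fun _ h => h⟩
  | succ m ih =>
    obtain ⟨c', h', t', h1, h2⟩ := ih (by omega) fun ⟨j, hj, hjm, hc⟩ => h ⟨j, hj, by omega, hc⟩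
    simp only [sufTo, List.foldl_append, h1]
    unfold blk
    split_ifs with hc
    · exact ⟨c', h', t', rfl, fun hm => h2 (by omega)⟩
    · rw [List.foldl_append, lastStep_replicate hc]
      by_cases hm : m ≤ s
      · have := h ⟨m, hm, by omega, hc⟩
        obtain ⟨c2, h4, h5⟩ := lastStep_dsc hm true t' (Or.inr ⟨h2 hm this, rfl⟩)
        exact ⟨c2, _, _, h4, fun hm' _ => h5 (by omega)⟩
      · rw [dsc_of_le (by omega)]
        exact ⟨c', true, t', rfl, by omega⟩

/-! ### The first nonempty block of a suffix -/

theorem sufTo_eq_nil {N m : ℕ} {c : ℕ → ℕ} (h : ∀ i < m, c i = 0) : sufTo N c m = [] := by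
  induction m with
  | zero => rfl
  | succ m ih => rw [sufTo, ih fun i hi => h i (by omega), blk, if_pos (h m (by omega))]; rfl

theorem sufTo_eq_blk_append {N m j : ℕ} {c : ℕ → ℕ} (hj : j < m) (h : ∀ i < j, c i = 0) :
    sufTo N c m = blk N (c j) j ++ sufTo N (Function.update c j 0) m := by
  induction m with
  | zero => omega
  | succ m ih =>
    rcases Nat.lt_succ_iff_lt_or_eq.1 hj with hj' | rfl
    · rw [sufTo, ih hj', sufTo, Function.update_of_ne (by omega), List.append_assoc]
    · have h1 : ∀ i < j + 1, Function.update c j 0 i = 0 := fun i hi => by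
        by_cases hij : i = j
        · simp [hij]
        · rw [Function.update_of_ne hij]; exact h i (by omega)
      rw [sufTo, sufTo_eq_nil h, sufTo_eq_nil h1]; simp

theorem sufTo_eq_cons {N m : ℕ} {c : ℕ → ℕ} (h : ∃ i < m, c i ≠ 0) : ∃ w, sufTo N c m = N :: w := by
  induction m with
  | zero => simp at h
  | succ m ih =>
    by_cases h' : ∃ i < m, c i ≠ 0
    · obtain ⟨w, hw⟩ := ih h'
      exact ⟨w ++ blk N (c m) m, by rw [sufTo, hw]; rfl⟩
    · push Not at h'
      obtain ⟨i, hi, hc⟩ := h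
      obtain rfl : i = m := by
        by_contra hne
        exact hc (h' i (by omega))
      obtain ⟨k, hk⟩ : ∃ k', c i = k' + 1 := ⟨c i - 1, by omega⟩
      exact ⟨List.replicate k N ++ dsc N i, by
        rw [sufTo, sufTo_eq_nil h', blk, if_neg hc, hk, List.replicate_succ]; rfl⟩

/-! ### Good canonical words are accepted by the automata -/

theorem exists_innerStep_canon {N i : ℕ} (hi : i + 1 < N) {x : PreData N} {c : ℕ → ℕ}
    (h : IsGood N x c) : ∃ t, (canon N x c).foldl (innerStep i) (some 2) = some t := by
  have key : ∃ c₀, (preWord N x).foldl (innerStep i) (some 2) = some c₀ ∧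
      ((∃ j ≤ i, j < N + 1 ∧ c j ≠ 0) → 1 ≤ c₀) := by
    rcases h with ⟨hc, h⟩ | ⟨j, hj, hcj, hc, h⟩
    · obtain ⟨c₀, h1, -, -⟩ := innerStep_preWord (i := i) h
      exact ⟨c₀, h1, fun ⟨j, _, hj, hcj⟩ => absurd (hc j (by omega)) hcj⟩
    · have hG : GoodAsc N j x := by
        rcases h with h | h
        · exact h.2
        · exact good_goodAsc h.2
      obtain ⟨c₀, h1, -, h2⟩ := innerStep_preWord_asc (i := i) hG
      refine ⟨c₀, h1, fun ⟨j', hj', _, hcj'⟩ => h2 ?_ (by omega)⟩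
      by_contra hlt
      exact hcj' (hc j' (by omega))
  obtain ⟨c₀, h1, h2⟩ := key
  obtain ⟨c', h3, -⟩ := innerStep_sufTo hi c h2
  exact ⟨c', by rw [canon, List.foldl_append, h1, h3]⟩

theorem exists_lastStep_canon {s : ℕ} {x : PreData (s + 1)} {c : ℕ → ℕ}
    (h : IsGood (s + 1) x c) :
    ∃ t, (canon (s + 1) x c).foldl (lastStep s) (some (2, false, false, false)) = some t := by
  -- This covers every case except a single block preceded by a prefix ending in the one-letter
  -- block s.
  have key : ∀ k, Good (s + 1) k x → ((∃ j ≤ s, j < s + 2 ∧ c j ≠ 0) → k ≤ s) →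
      ∃ t, (canon (s + 1) x c).foldl (lastStep s) (some (2, false, false, false)) = some t := by
    intro k hk h1
    obtain ⟨c₀, h2, h3⟩ := lastStep_preWord hk
    obtain ⟨c', h', t', h4, -⟩ := lastStep_sufTo (s := s) c le_rfl fun h => h3 (h1 h)
    exact ⟨_, by rw [canon, List.foldl_append, h2, h4]⟩
  rcases h with ⟨hc, h⟩ | ⟨j, hj, hcj, hc, h⟩
  · exact key _ h fun ⟨j, _, hj, hcj⟩ => absurd (hc j (by omega)) hcj
  · have hle : (∃ j ≤ s, j < s + 2 ∧ c j ≠ 0) → j ≤ s := fun ⟨j', hj', _, hcj'⟩ => by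
      by_contra hlt
      exact hcj' (hc j' (by omega))
    rcases h with ⟨hz, h⟩ | h
    · obtain ⟨x, e, he⟩ := x
      rcases h with h | ⟨h, hjs, hx⟩
      · exact key j h hle
      · simp only at h
        subst h
        obtain ⟨c1, h1, h2, -⟩ := lastStep_of_notMem (s := e) (w := preWord e x)
          (fun y hy => mem_preWord hy) 2 false false false
        obtain ⟨c2, h3, -, -⟩ := lastStep_of_notMem (s := e) (w := dsc e j)
          (fun y hy => (mem_dsc.1 hy).2) 0 false true true
        have h4 : sufTo (e + 1) c (e + 1 + 1) = blk (e + 1) (c j) j := by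
          rw [sufTo_eq_blk_append (j := j) (by omega) hc, sufTo_eq_nil, List.append_nil]
          intro i hi
          by_cases hij : i = j
          · simp [hij]
          · rw [Function.update_of_ne hij]
            rcases Nat.lt_or_ge i j with h | h
            · exact hc i h
            · exact hz i (by omega) (by omega)
        have h5 : dsc (e + 1) e = [e] := by rw [dsc_succ le_rfl, dsc_of_le le_rfl]
        refine ⟨(c2, false, true, true), ?_⟩
        show (preWord (e + 1) (x, ⟨e, he⟩) ++ sufTo (e + 1) c (e + 1 + 1)).foldl _ _ = _
        rw [h4, blk, if_neg hcj, dsc_succ hjs]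
        simp only [preWord, h5, List.foldl_append, h1, List.foldl_cons, List.foldl_nil]
        -- Here the word contains e, a power of e + 1, then e again, with no e - 1 in between. It is
        -- tolerated because no e + 1 occurred before; the automaton then locks, and the remaining
        -- letters are all below e.
        have h6 : lastStep e (some (c1, false, false, false)) e = some (0, false, false, false) := by
          simp [lastStep, h2]
        rw [h6, lastStep_replicate hcj]
        simpa [lastStep] using h3
    · exact key j h.2 hle

/-! ### Braid factors are rejected from every state -/

theorem innerStep_braid (i : ℕ) (t : Option ℕ) :
    [i, i + 1, i].foldl (innerStep i) t = none := by
  rcases t with _ | c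
  · rfl
  · by_cases h : 2 ≤ c <;> simp [innerStep, h]

theorem innerStep_braid' (i : ℕ) (t : Option ℕ) :
    [i + 1, i, i + 1].foldl (innerStep (i + 1)) t = none := by
  rcases t with _ | c
  · rfl
  · by_cases h : 2 ≤ c <;> simp [innerStep, h]

theorem lastStep_braid (i : ℕ) (t : Option LastState) :
    [i + 1, i, i + 1].foldl (lastStep (i + 1)) t = none := by
  rcases t with _ | ⟨c, h, t, f⟩
  · rfl
  · have h1 : lastStep (i + 1) (some (c, h, t, f)) (i + 1) = none ∨
        ∃ t' f', lastStep (i + 1) (some (c, h, t, f)) (i + 1) = some (0, false, t', f') := by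
      simp only [lastStep]
      rw [if_neg (by omega), if_pos trivial]
      split_ifs <;> simp
    rw [List.foldl_cons, List.foldl_cons]
    rcases h1 with h1 | ⟨t', f', h1⟩
    · rw [h1]
      rfl
    · have h2 : lastStep (i + 1) (some (0, false, t', f')) i = some (1, false, t', f') := by
        simp [lastStep]
        omega
      rw [h1, h2]
      simp [lastStep]

theorem lastStep_replicate_none (s k : ℕ) :
    (List.replicate k (s + 1)).foldl (lastStep s) none = none :=
  foldl_none (δ := lastStep s) (fun _ => rfl) _

theorem lastStep_replicate_locked {s k : ℕ} (hk : k ≠ 0) (c : ℕ) (h t : Bool) :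
    (List.replicate k (s + 1)).foldl (lastStep s) (some (c, h, t, true)) = none := by
  obtain ⟨k, rfl⟩ : ∃ k', k = k' + 1 := ⟨k - 1, by omega⟩
  rw [List.replicate_succ, List.foldl_cons]
  simp only [lastStep, if_true]
  exact lastStep_replicate_none s k

/-- The leading power of s + 1 is recorded, so the first s, if read, sets the third state component.
The second s then has no s - 1 since the first and cannot use the exception, which requires that
component to be false. -/
theorem lastStep_last {s a b : ℕ} (ha : a ≠ 0) (hb : b ≠ 0) (t : Option LastState) :
    (List.replicate a (s + 1) ++ s :: (List.replicate b (s + 1) ++ [s])).foldl (lastStep s) t =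
      none := by
  rcases t with _ | ⟨c, h, t, f⟩
  · exact foldl_none (δ := lastStep s) (fun _ => rfl) _
  · simp only [List.foldl_append, List.foldl_cons, List.foldl_nil]
    cases f with
    | true =>
      rw [lastStep_replicate_locked ha]
      simp only [lastStep]
      rw [lastStep_replicate_none]
    | false =>
      rw [lastStep_replicate ha]
      simp only [lastStep]
      rw [if_neg (by omega), if_pos trivial]
      split_ifs
      · rw [lastStep_replicate hb]
        simp
      · rw [lastStep_replicate_locked hb]
      · rw [lastStep_replicate_none]

/-- The second s can only be read through the exception, which locks the automaton, and the trailing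
power of s + 1 is then refused. -/
theorem lastStep_last' {s a b : ℕ} (ha : a ≠ 0) (hb : b ≠ 0) (t : Option LastState) :
    (s :: (List.replicate b (s + 1) ++ s :: List.replicate a (s + 1))).foldl (lastStep s) t =
      none := by
  rcases t with _ | ⟨c, h, t, f⟩
  · exact foldl_none (δ := lastStep s) (fun _ => rfl) _
  · have key : ∀ t' f', (s :: List.replicate a (s + 1)).foldl (lastStep s)
        ((List.replicate b (s + 1)).foldl (lastStep s) (some (0, false, t', f'))) = none := by
      intro t' f'
      cases f' with
      | true => rw [lastStep_replicate_locked hb]; exact foldl_none (δ := lastStep s) (fun _ => rfl) _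
      | false =>
        rw [lastStep_replicate hb, List.foldl_cons]
        simp only [lastStep]
        rw [if_neg (by omega), if_pos trivial, if_neg (by simp)]
        split_ifs
        · rw [lastStep_replicate_locked ha]
        · exact foldl_none (δ := lastStep s) (fun _ => rfl) _
    rw [List.foldl_cons, List.foldl_append]
    simp only [lastStep]
    rw [if_neg (by omega), if_pos trivial]
    split_ifs
    · exact key _ _
    · exact key _ _
    · rw [lastStep_replicate_none]
      exact foldl_none (δ := lastStep s) (fun _ => rfl) _

theorem IsGood.not_cm {N : ℕ} {x : PreData N} {c : ℕ → ℕ} (h : IsGood N x c) {l r : List ℕ}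
    (hlr : BraidRel N l r) (a b : List ℕ) :
    ¬ Cm (canon N x c) (a ++ l ++ b) ∧ ¬ Cm (canon N x c) (a ++ r ++ b) := by
  have inner : ∀ i l, i + 1 < N → (∀ t, List.foldl (innerStep i) t l = none) →
      ¬ Cm (canon N x c) (a ++ l ++ b) := by
    intro i l hi hl
    obtain ⟨t, ht⟩ := exists_innerStep_canon hi h
    exact not_cm_of_foldl (innerStep_comm i) (fun _ => rfl) ht hl a b
  have last : ∀ s l, s + 1 = N → (∀ t, List.foldl (lastStep s) t l = none) →
      ¬ Cm (canon N x c) (a ++ l ++ b) := by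
    rintro s l rfl hl
    obtain ⟨t, ht⟩ := exists_lastStep_canon h
    exact not_cm_of_foldl (lastStep_comm s) (fun _ => rfl) ht hl a b
  cases hlr with
  | braid i hi =>
    refine ⟨inner i _ hi (innerStep_braid i), ?_⟩
    -- The repeated letter is now i + 1; when it is N - 1, the neighbour of the last generator, its
    -- automaton is `lastStep`.
    rcases Nat.lt_or_ge (i + 1 + 1) N with h' | h'
    · exact inner (i + 1) _ h' (innerStep_braid' i)
    · exact last (i + 1) _ (by omega) (lastStep_braid i)
  | last s k l hs hk hl =>
    subst hs
    exact ⟨last s _ rfl (lastStep_last (by omega) (by omega)),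
      last s _ rfl (lastStep_last' (by omega) (by omega))⟩

/-! ### Inadmissible parameters -/

/-- Some commutation equivalent word contains one side of a braid relation. -/
def HasBraid (N : ℕ) (w : List ℕ) : Prop :=
  ∃ a l r b, (BraidRel N l r ∨ BraidRel N r l) ∧ Cm w (a ++ l ++ b)

theorem HasBraid.append {N : ℕ} {w : List ℕ} (h : HasBraid N w) (p q : List ℕ) :
    HasBraid N (p ++ w ++ q) := by
  obtain ⟨a, l, r, b, hlr, hw⟩ := h
  refine ⟨p ++ a, l, r, b ++ q, hlr, ?_⟩
  have := CommEquiv.append (CommEquiv.append (Relation.EqvGen.refl p) hw) (Relation.EqvGen.refl q)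
  simpa using this

theorem HasBraid.append_right {N : ℕ} {w : List ℕ} (h : HasBraid N w) (q : List ℕ) :
    HasBraid N (w ++ q) := h.append [] q

theorem HasBraid.of_cm {N : ℕ} {u v : List ℕ} (h : HasBraid N v) (huv : Cm u v) :
    HasBraid N u := by
  obtain ⟨a, l, r, b, hlr, hw⟩ := h
  exact ⟨a, l, r, b, hlr, huv.trans _ _ _ hw⟩

/-- The final e of the first run commutes with everything up to the letter e + 1 of the second run,
where it meets e + 1, e. -/
theorem hasBraid_pair {N p q e k : ℕ} {w : List ℕ} (hk : k ≤ e) (hp : e < p) (hq : e + 1 < q)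
    (hqN : q ≤ N) (hw : ∀ y ∈ w, e + 1 < y) : HasBraid N (dsc p e ++ w ++ dsc q k) := by
  have h1 : dsc q k = dsc q (e + 2) ++ ([e + 1, e] ++ dsc e k) := by
    rw [dsc_append (q := e + 2) (by omega) (by omega), dsc_succ (p := e + 1) (by omega),
      dsc_succ (p := e) hk]
    rfl
  have h2 : Cm (e :: (w ++ dsc q (e + 2))) (w ++ dsc q (e + 2) ++ [e]) :=
    cm_far fun y hy => by
      rw [List.mem_append, mem_dsc] at hy
      rcases hy with hy | hy
      · exact Or.inl (hw y hy)
      · omega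
  have h3 : HasBraid N [e, e + 1, e] :=
    ⟨[], _, _, [], Or.inl (.braid e (by omega)), .refl _⟩
  have h4 := h3.append (dsc p (e + 1) ++ (w ++ dsc q (e + 2))) (dsc e k)
  refine h4.of_cm ?_
  rw [dsc_snoc hp, h1]
  have := CommEquiv.append (CommEquiv.append (Relation.EqvGen.refl (dsc p (e + 1))) h2)
    (Relation.EqvGen.refl ([e + 1, e] ++ dsc e k))
  simpa using this

/-- The appended run acts as one more block. Going back through the nonempty blocks, the first
failure of increasing ends is a pair as in `hasBraid_pair`. -/
theorem hasBraid_preWord_dsc {N m q k : ℕ} (hm : m < q) (hq : q ≤ N) {x : PreData m}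
    (h : ¬ Good m k x) : HasBraid N (preWord m x ++ dsc q k) := by
  induction m generalizing q k with
  | zero => exact absurd trivial h
  | succ m ih =>
    obtain ⟨x, e, he⟩ := x
    simp only [Good, not_or, not_and] at h
    simp only [preWord]
    rcases Nat.lt_or_ge m e with h1 | h1
    · rw [dsc_of_le h1, List.append_nil]
      exact ih (by omega) hq (h.1 (by omega))
    · rcases Nat.lt_or_ge e k with h2 | h2
      · exact (ih (by omega) (by omega) (h.2 h1 h2)).append_right _
      · have := hasBraid_pair (w := []) h2 (by omega : e < m + 1) (by omega) hq (by simp)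
        simpa using this.append (preWord m x) []

theorem hasBraid_preWord {N m k : ℕ} (hk : m ≤ k) (hm : m ≤ N) {x : PreData m}
    (h : ¬ Good m k x) : HasBraid N (preWord m x) := by
  induction m with
  | zero => exact absurd trivial h
  | succ m ih =>
    obtain ⟨x, e, he⟩ := x
    simp only [Good, not_or, not_and] at h
    simp only [preWord]
    rcases Nat.lt_or_ge m e with h1 | h1
    · rw [dsc_of_le h1, List.append_nil]
      exact ih (by omega) (by omega) (h.1 (by omega))
    · exact hasBraid_preWord_dsc (by omega) (by omega) (h.2 h1 (by omega))

/-- The intermediate letters w are far enough from the end of the last nonempty prefix block for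
that end to commute past them. -/
theorem hasBraid_preWord_far {N m k : ℕ} (hm : m < N) {x : PreData m} {w : List ℕ}
    (hw : ∀ y ∈ w, m < y) (h : ¬ Good m k x) : HasBraid N (preWord m x ++ (w ++ dsc N k)) := by
  induction m with
  | zero => exact absurd trivial h
  | succ m ih =>
    obtain ⟨x, e, he⟩ := x
    simp only [Good, not_or, not_and] at h
    simp only [preWord]
    rcases Nat.lt_or_ge m e with h1 | h1
    · rw [dsc_of_le h1, List.append_nil]
      exact ih (by omega) (fun y hy => (Nat.lt_succ_self m).trans (hw y hy)) (h.1 (by omega))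
    · rcases Nat.lt_or_ge e k with h2 | h2
      · exact (hasBraid_preWord_dsc (by omega) (by omega) (h.2 h1 h2)).append_right _
      · have := hasBraid_pair (w := w) h2 (by omega : e < m + 1) (by omega) (le_refl N)
          fun y hy => by have := hw y hy; omega
        simpa using this.append (preWord m x) []

/-- A final one-letter block that the ascending form permits is absorbed into w, and the search for
a violation continues to its left. -/
theorem hasBraid_preWord_asc {N m k : ℕ} (hm : m ≤ N) {x : PreData m} {w : List ℕ}
    (hw : ∀ y ∈ w, m ≤ y) (h : ¬ GoodAsc m k x) :
    HasBraid N (preWord m x ++ (w ++ dsc N k)) := by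
  induction m generalizing w with
  | zero => exact absurd trivial h
  | succ m ih =>
    obtain ⟨x, e, he⟩ := x
    simp only [GoodAsc, Good, not_or, not_and] at h
    simp only [preWord]
    rcases Nat.lt_or_ge m e with h1 | h1
    · rw [dsc_of_le h1, List.append_nil]
      exact hasBraid_preWord_far (by omega) hw (h.1.1 (by omega))
    · rcases Nat.lt_or_ge e k with h2 | h2
      · exact (hasBraid_preWord_dsc (by omega) (by omega) (h.1.2 h1 h2)).append_right _
      · rcases Nat.lt_or_ge e m with h3 | h3
        · have := hasBraid_pair (w := w) h2 (by omega : e < m + 1) (by omega) (le_refl N)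
            fun y hy => by have := hw y hy; omega
          simpa using this.append (preWord m x) []
        · obtain rfl : e = m := by omega
          have h4 : dsc (e + 1) e = [e] := by rw [dsc_succ le_rfl, dsc_of_le le_rfl]
          have := ih (w := e :: w) (by omega) (fun y hy => by
            rcases List.mem_cons.1 hy with rfl | hy
            · exact le_rfl
            · exact (Nat.le_succ _).trans (hw y hy)) (h.2 rfl h2)
          simpa [h4] using this

/-- The new case compared with a single block is a prefix ending in s: the next power of s + 1
commutes left past the letters below s and completes the factor s (s+1)^k s (s+1). -/
theorem hasBraid_preWord_last {s k j : ℕ} (hk : k ≠ 0) (hj : j ≤ s) {x : PreData (s + 1)}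
    (h : ¬ Good (s + 1) j x) (w : List ℕ) :
    HasBraid (s + 1) (preWord (s + 1) x ++ (blk (s + 1) k j ++ (s + 1) :: w)) := by
  obtain ⟨x, e, he⟩ := x
  simp only [Good, not_or, not_and] at h
  simp only [preWord, blk, if_neg hk]
  have hw : ∀ y ∈ List.replicate k (s + 1), s < y := fun y hy => by
    rw [List.mem_replicate] at hy; omega
  rcases Nat.lt_or_ge s e with h1 | h1
  · rw [dsc_of_le h1, List.append_nil]
    have := hasBraid_preWord_far (Nat.lt_succ_self s) hw (h.1 (by omega))
    simpa using this.append_right ((s + 1) :: w)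
  · rcases Nat.lt_or_ge e j with h2 | h2
    · have := hasBraid_preWord_dsc (N := s + 1) (Nat.lt_succ_self s) le_rfl (h.2 h1 h2)
      exact this.append_right _
    · rcases Nat.lt_or_ge e s with h3 | h3
      · have := hasBraid_pair (q := s + 1) (w := List.replicate k (s + 1)) h2 (by omega : e < s + 1)
          (by omega) le_rfl fun y hy => by have := hw y hy; omega
        simpa using this.append (preWord s x) ((s + 1) :: w)
      · obtain rfl : e = s := by omega
        have h4 : dsc (e + 1) e = [e] := by rw [dsc_succ le_rfl, dsc_of_le le_rfl]
        have h5 : Cm ((e + 1) :: dsc e j) (dsc e j ++ [e + 1]) :=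
          cm_far fun y hy => by rw [mem_dsc] at hy; omega
        have h6 : HasBraid (e + 1)
            (e :: (List.replicate k (e + 1) ++ e :: List.replicate 1 (e + 1))) :=
          ⟨[], _, _, [], Or.inr (.last e 1 k rfl le_rfl (by omega)), by
            rw [List.nil_append, List.append_nil]; exact .refl _⟩
        refine (h6.append (preWord e x) (dsc e j ++ w)).of_cm ?_
        rw [h4, dsc_succ hj]
        have := CommEquiv.append (CommEquiv.append
          (Relation.EqvGen.refl (preWord e x ++ e :: (List.replicate k (e + 1) ++ [e]))) h5.symm)
          (Relation.EqvGen.refl w)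
        simpa using this

theorem hasBraid_of_not_isGood {N : ℕ} {x : PreData N} {c : ℕ → ℕ} (h : ¬ IsGood N x c) :
    HasBraid N (canon N x c) := by
  rw [IsGood, not_or] at h
  by_cases h0 : ∀ i ≤ N, c i = 0
  · exact (hasBraid_preWord le_rfl le_rfl fun hg => h.1 ⟨h0, hg⟩).append_right _
  · push Not at h0
    have hex : ∃ i, i ≤ N ∧ c i ≠ 0 := h0
    classical
    set j := Nat.find hex with hj
    obtain ⟨hjN, hcj⟩ := Nat.find_spec hex
    rw [← hj] at hjN hcj
    have hlt : ∀ i < j, c i = 0 := fun i hi => by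
      by_contra hne
      exact Nat.find_min hex hi ⟨by omega, hne⟩
    have h2 := h.2
    push Not at h2
    have h3 := h2 j hjN hcj hlt
    rw [canon, sufTo_eq_blk_append (by omega : j < N + 1) hlt]
    by_cases hz : ∀ i, j < i → i ≤ N → c i = 0
    · have h4 := hasBraid_preWord_asc le_rfl (w := List.replicate (c j) N) (fun y hy => by
        rw [List.mem_replicate] at hy; omega) (h3.1 hz)
      rw [blk, if_neg hcj]
      simpa using h4.append_right (sufTo N (Function.update c j 0) (N + 1))
    · push Not at hz
      obtain ⟨i, hji, hiN, hci⟩ := hz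
      obtain ⟨s, rfl⟩ : ∃ s, N = s + 1 := ⟨N - 1, by omega⟩
      -- Of the later blocks only their first letter N is used.
      obtain ⟨w, hw⟩ := sufTo_eq_cons (N := s + 1) (m := s + 1 + 1) (c := Function.update c j 0)
        ⟨i, by omega, by rwa [Function.update_of_ne (by omega)]⟩
      rw [hw]
      exact hasBraid_preWord_last hcj (by omega) (h3.2 ⟨i, hji, hiN, hci⟩) w

theorem isFullyCommutative_iff {d N : ℕ} (hd : 1 ≤ d) (p : CanonData d N) :
    IsFullyCommutative d (N + 1) (wp d N (canonWord p)) ↔ IsGood N p.1 (col p.2) := by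
  constructor
  · intro h
    by_contra hg
    obtain ⟨a, l, r, b, hlr, hcm⟩ := hasBraid_of_not_isGood hg
    exact not_isFullyCommutative_of_cm hd p hlr hcm h
  · exact fun h => isFullyCommutative_of_forall hd p fun a b l r hlr => h.not_cm hlr a b

/-! ### Catalan triangle identities -/

theorem catalanTriangle_zero (n : ℕ) : catalanTriangle n 0 = 1 := by
  have h : ((n : ℚ) + 1) ≠ 0 := by positivity
  have h' : (n.factorial : ℚ) ≠ 0 := by positivity
  rw [catalanTriangle, Nat.factorial_succ]
  push_cast
  field_simp
  simp [mul_comm]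

theorem catalanTriangle_succ_succ (n k : ℕ) :
    catalanTriangle (n + 1) (k + 1) = catalanTriangle (n + 1) k + catalanTriangle n (k + 1) := by
  have h1 : (n + 1 + (k + 1)).factorial = (n + k + 2) * (n + k + 1).factorial := by
    rw [← Nat.factorial_succ]; congr 1; omega
  have h2 : (n + (k + 1)).factorial = (n + k + 1).factorial := rfl
  have h3 : (n + 1 + k).factorial = (n + k + 1).factorial := by congr 1; omega
  have h4 : (n + 1 + 1).factorial = (n + 2) * (n + 1).factorial := Nat.factorial_succ _
  have h5 : (k + 1).factorial = (k + 1) * k.factorial := Nat.factorial_succ _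
  have e1 : (k.factorial : ℚ) ≠ 0 := by positivity
  have e2 : ((n + 1).factorial : ℚ) ≠ 0 := by positivity
  have e3 : ((n : ℚ) + 2) ≠ 0 := by positivity
  have e4 : ((k : ℚ) + 1) ≠ 0 := by positivity
  simp only [catalanTriangle, h1, h2, h3, h4, h5]
  push_cast
  field_simp
  ring

theorem catalanTriangle_succ_self (n : ℕ) :
    catalanTriangle (n + 1) (n + 1) = catalanTriangle (n + 1) n := by
  rw [catalanTriangle_succ_succ]
  simp [catalanTriangle]

theorem catalanTriangle_self (n : ℕ) : catalanTriangle n n = catalan n := by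
  have h := succ_mul_catalan_eq_centralBinom n
  have h2 : (n.centralBinom : ℚ) = ((2 * n).factorial : ℚ) / (n.factorial * n.factorial) := by
    rw [Nat.centralBinom, Nat.cast_choose ℚ (by omega), (by omega : 2 * n - n = n)]
  rw [← h] at h2
  have e1 : (n.factorial : ℚ) ≠ 0 := by positivity
  have e3 : ((n : ℚ) + 1) ≠ 0 := by positivity
  rw [catalanTriangle, Nat.factorial_succ, ← two_mul]
  push_cast at h2 ⊢
  rw [eq_div_iff (by positivity)] at h2
  rw [div_eq_iff (by positivity), sub_self, zero_add, mul_one, ← h2]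
  ring

theorem eval_catalanTrianglePoly (n k : ℕ) (x : ℚ) :
    (catalanTrianglePoly n k).eval x =
      ∑ s ∈ Finset.range (k + 1), catalanTriangle n s * x ^ (k - s) := by
  simp [catalanTrianglePoly, Polynomial.eval_finsetSum]

/-! ### The specialisation at 2 -/

/-- The right-hand side is the binomial coefficient of n + k + 1 over k; it satisfies the Horner
recursion F(k+1) = 2 F(k) + C(n,k+1) of the left-hand side. -/
theorem eval_two_catalanTrianglePoly (n k : ℕ) :
    (catalanTrianglePoly n k).eval 2 =
      ((n + k + 1).factorial : ℚ) / (k.factorial * (n + 1).factorial) := by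
  rw [eval_catalanTrianglePoly]
  induction k with
  | zero =>
    have e2 : ((n + 1).factorial : ℚ) ≠ 0 := by positivity
    simp [catalanTriangle_zero, e2]
  | succ k ih =>
    have h : ∑ s ∈ Finset.range (k + 1), catalanTriangle n s * (2 : ℚ) ^ (k + 1 - s) =
        2 * ∑ s ∈ Finset.range (k + 1), catalanTriangle n s * (2 : ℚ) ^ (k - s) := by
      rw [Finset.mul_sum]
      refine Finset.sum_congr rfl fun s hs => ?_
      rw [Finset.mem_range] at hs
      rw [(by omega : k + 1 - s = k - s + 1), pow_succ]
      ring
    rw [Finset.sum_range_succ, h, ih, catalanTriangle]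
    have h1 : (n + (k + 1) + 1).factorial = (n + k + 2) * (n + k + 1).factorial :=
      Nat.factorial_succ _
    have h2 : (n + (k + 1)).factorial = (n + k + 1).factorial := rfl
    have h5 : (k + 1).factorial = (k + 1) * k.factorial := Nat.factorial_succ _
    have e1 : (k.factorial : ℚ) ≠ 0 := by positivity
    have e2 : ((n + 1).factorial : ℚ) ≠ 0 := by positivity
    have e4 : ((k : ℚ) + 1) ≠ 0 := by positivity
    rw [h1, h2, h5]
    push_cast
    simp only [Nat.sub_self, pow_zero, mul_one]
    field_simp
    ring

theorem two_mul_eval_two_catalanTrianglePoly {n : ℕ} (hn : 2 ≤ n) :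
    2 * (catalanTrianglePoly n (n - 2)).eval 2 = ((n : ℚ) - 1) * catalan n := by
  obtain ⟨m, rfl⟩ : ∃ m, n = m + 2 := ⟨n - 2, by omega⟩
  rw [eval_two_catalanTrianglePoly, ← catalanTriangle_self, catalanTriangle]
  have h1 : (m + 2 + (m + 2)).factorial = (2 * m + 4) * (2 * m + 3).factorial := by
    rw [← Nat.factorial_succ]; congr 1; omega
  have h2 : (m + 2 + (m + 2 - 2) + 1).factorial = (2 * m + 3).factorial := by congr 1; omega
  have h3 : (m + 2).factorial = (m + 2) * ((m + 1) * m.factorial) := by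
    rw [Nat.factorial_succ, Nat.factorial_succ]
  have e1 : (m.factorial : ℚ) ≠ 0 := by positivity
  have e2 : ((m + 2 + 1).factorial : ℚ) ≠ 0 := by positivity
  have e3 : ((m : ℚ) + 2) ≠ 0 := by positivity
  have e4 : ((m : ℚ) + 1) ≠ 0 := by positivity
  rw [h1, h2, h3, Nat.add_sub_cancel]
  push_cast
  field_simp
  ring

/-! ### Counting admissible prefixes -/

open scoped Classical in
/-- The number of prefixes satisfying `Good`. -/
noncomputable def goodCount (m k : ℕ) : ℕ := ∑ x : PreData m, if Good m k x then 1 else 0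

open scoped Classical in
/-- The number of prefixes satisfying `GoodAsc`. -/
noncomputable def goodAscCount (m k : ℕ) : ℕ := ∑ x : PreData m, if GoodAsc m k x then 1 else 0

theorem sum_preData_succ {m : ℕ} (f : PreData m × Fin (m + 2) → ℕ) :
    (∑ p : PreData (m + 1), f p) = ∑ e : Fin (m + 2), ∑ x : PreData m, f (x, e) :=
  Fintype.sum_prod_type_right f

theorem goodCount_zero_left (k : ℕ) : goodCount 0 k = 1 := by
  classical
  have h : ∀ x : PreData 0, (if Good 0 k x then 1 else 0) = 1 := fun x => if_pos trivial
  rw [goodCount, Finset.sum_congr rfl fun x _ => h x, Finset.sum_const,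
    Finset.card_univ, card_preData]
  rfl

theorem goodCount_succ (m k : ℕ) :
    goodCount (m + 1) k =
      ∑ e ∈ Finset.range (m + 1), (if e < k then goodCount m e else 0) + goodCount m k := by
  classical
  have h : goodCount (m + 1) k = ∑ e : Fin (m + 2), ∑ x : PreData m,
      if Good (m + 1) k (x, e) then 1 else 0 :=
    sum_preData_succ fun p => if Good (m + 1) k p then 1 else 0
  rw [h, Fin.sum_univ_castSucc, Finset.sum_range]
  congr 1
  · refine Finset.sum_congr rfl fun e _ => ?_
    have he := e.2
    have : ∀ x : PreData m, Good (m + 1) k (x, e.castSucc) ↔ e.val < k ∧ Good m e x := by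
      intro x
      simp only [Good, Fin.val_castSucc]
      constructor
      · rintro (⟨h, -⟩ | ⟨-, h⟩)
        · omega
        · exact h
      · exact fun h => Or.inr ⟨by omega, h⟩
    simp only [this]
    split_ifs with hk
    · simp [hk, goodCount]
    · simp [hk]
  · refine Finset.sum_congr rfl fun x _ => ?_
    have : Good (m + 1) k (x, Fin.last (m + 1)) ↔ Good m k x := by
      simp [Good]
    simp only [this]

theorem goodCount_zero_right (m : ℕ) : goodCount m 0 = 1 := by
  induction m with
  | zero => exact goodCount_zero_left 0
  | succ m ih => rw [goodCount_succ, ih]; simp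

/-- Raising the bound from k to k + 1 allows exactly one new end k for the last block, and the
earlier blocks then satisfy the bound k. Together with the prefixes whose last block is empty this
gives the Catalan triangle recursion. -/
theorem goodCount_succ_succ {m k : ℕ} (hk : k ≤ m) :
    goodCount (m + 1) (k + 1) = goodCount (m + 1) k + goodCount m (k + 1) := by
  rw [goodCount_succ, goodCount_succ]
  have : ∑ e ∈ Finset.range (m + 1), (if e < k + 1 then goodCount m e else 0) =
      ∑ e ∈ Finset.range (m + 1), (if e < k then goodCount m e else 0) + goodCount m k := by
    have h : ∀ e, (if e < k + 1 then goodCount m e else 0) =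
        (if e < k then goodCount m e else 0) + if e = k then goodCount m e else 0 := by
      intro e
      split_ifs <;> omega
    rw [Finset.sum_congr rfl fun e _ => h e, Finset.sum_add_distrib, Finset.sum_ite_eq' _ k,
      if_pos (by rw [Finset.mem_range]; omega)]
  omega

theorem goodCount_stable {m k : ℕ} (hk : m ≤ k) : goodCount m (k + 1) = goodCount m k := by
  induction m generalizing k with
  | zero => rw [goodCount_zero_left, goodCount_zero_left]
  | succ m ih =>
    rw [goodCount_succ, goodCount_succ, ih (by omega)]
    congr 1
    refine Finset.sum_congr rfl fun e he => ?_
    rw [Finset.mem_range] at he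
    rw [if_pos (by omega), if_pos (by omega)]

theorem goodCount_eq {m k : ℕ} (hk : k ≤ m + 1) : (goodCount m k : ℚ) = catalanTriangle (m + 1) k := by
  induction m generalizing k with
  | zero =>
    rw [goodCount_zero_left]
    interval_cases k
    · simp [catalanTriangle_zero]
    · rw [catalanTriangle_succ_self, catalanTriangle_zero]; simp
  | succ m ihm =>
    induction k with
    | zero => rw [goodCount_zero_right, catalanTriangle_zero]; simp
    | succ k ih =>
      rcases Nat.lt_or_ge m k with h | h
      -- On the boundary the recursion is unavailable: the bound m + 2 restricts no more than m + 1,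
      -- matching C(n,n) = C(n,n-1).
      · obtain rfl : k = m + 1 := by omega
        rw [goodCount_stable le_rfl, ih (by omega), ← catalanTriangle_succ_self]
      · rw [goodCount_succ_succ h, Nat.cast_add, ih (by omega), ihm (by omega),
          ← catalanTriangle_succ_succ]

theorem goodAscCount_succ (m k : ℕ) :
    goodAscCount (m + 1) k = goodCount (m + 1) k + if k ≤ m then goodAscCount m k else 0 := by
  classical
  have h1 : ∀ p : PreData m × Fin (m + 2), (if GoodAsc (m + 1) k p then 1 else 0) =
      (if Good (m + 1) k p then 1 else 0) +
        if p.2.val = m ∧ k ≤ m ∧ GoodAsc m k p.1 then 1 else 0 := by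
    rintro ⟨x, e⟩
    have h2 : Good (m + 1) k (x, e) → ¬ (e.val = m ∧ k ≤ m ∧ GoodAsc m k x) := by
      rintro (⟨h, -⟩ | ⟨-, h, -⟩) ⟨h', h'', -⟩ <;> omega
    by_cases h3 : Good (m + 1) k (x, e)
    · simp only [GoodAsc, h3, true_or, if_true]
      rw [if_neg (h2 h3)]
    · simp only [GoodAsc, h3, false_or, if_false, zero_add]
  have h2 : goodAscCount (m + 1) k = ∑ p : PreData (m + 1), ((if Good (m + 1) k p then 1 else 0) +
        if p.2.val = m ∧ k ≤ m ∧ GoodAsc m k p.1 then 1 else 0) :=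
    Finset.sum_congr rfl fun p _ => h1 p
  rw [h2, Finset.sum_add_distrib]
  congr 1
  rw [sum_preData_succ (fun p => if p.2.val = m ∧ k ≤ m ∧ GoodAsc m k p.1 then 1 else 0),
    Finset.sum_eq_single (⟨m, by omega⟩ : Fin (m + 2))]
  · split_ifs with hk
    · simp [hk, goodAscCount]
    · simp [hk]
  · intro e _ he
    refine Finset.sum_eq_zero fun x _ => if_neg fun h => he (Fin.ext h.1)
  · simp

/-- Removing the final letter of the ascending tail yields the same recursion, now along fixed k
with m varying. -/
theorem goodAscCount_eq {m k : ℕ} (hk : k ≤ m) :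
    (goodAscCount m k : ℚ) = catalanTriangle (m + 1) (k + 1) := by
  induction m with
  | zero =>
    obtain rfl : k = 0 := by omega
    have : goodAscCount 0 0 = goodCount 0 0 := rfl
    rw [this, goodCount_eq (by omega), catalanTriangle_succ_self]
  | succ m ih =>
    rw [goodAscCount_succ, Nat.cast_add, goodCount_eq (by omega)]
    split_ifs with h
    · rw [ih h, ← catalanTriangle_succ_succ]
    · obtain rfl : k = m + 1 := by omega
      rw [catalanTriangle_succ_self (m + 1)]
      simp

/-! ### Suffix data -/

/-- The list of parameters of the blocks of the suffix with exponents `c`. -/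
def toL (c : ℕ → ℕ) : ℕ → List (ℕ × ℕ)
  | 0 => []
  | m + 1 => toL c m ++ if c m = 0 then [] else [(c m, m + 1)]

theorem mem_toL {c : ℕ → ℕ} {m : ℕ} {b : ℕ × ℕ} :
    b ∈ toL c m ↔ ∃ j < m, c j ≠ 0 ∧ b = (c j, j + 1) := by
  induction m with
  | zero => simp [toL]
  | succ m ih =>
    rw [toL, List.mem_append, ih]
    constructor
    · rintro (⟨j, hj, h⟩ | h)
      · exact ⟨j, by omega, h⟩
      · split_ifs at h with hc
        · simp at h
        · exact ⟨m, by omega, hc, by simpa using h⟩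
    · rintro ⟨j, hj, hc, rfl⟩
      rcases Nat.lt_succ_iff_lt_or_eq.1 hj with hj | rfl
      · exact Or.inl ⟨j, hj, hc, rfl⟩
      · right; simp [hc]

theorem pairwise_toL (c : ℕ → ℕ) (m : ℕ) : (toL c m).Pairwise fun a b => a.2 < b.2 := by
  induction m with
  | zero => simp [toL]
  | succ m ih =>
    rw [toL, List.pairwise_append]
    refine ⟨ih, by split_ifs <;> simp, fun a ha b hb => ?_⟩
    obtain ⟨j, hj, -, rfl⟩ := mem_toL.1 ha
    split_ifs at hb with hc
    · simp at hb
    · obtain rfl : b = (c m, m + 1) := by simpa using hb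
      simpa using hj

theorem col_lt {d n : ℕ} (c : Fin n → Fin d) {j : ℕ} (hj : j < n) : col c j < d := by
  rw [col, dif_pos hj]; exact (c _).2

theorem isSuffixData_toL {d n : ℕ} (c : Fin n → Fin d) : IsSuffixData d n (toL (col c) n) := by
  refine ⟨fun b hb => ?_, pairwise_toL _ _⟩
  obtain ⟨j, hj, hc, rfl⟩ := mem_toL.1 hb
  have := col_lt c hj
  refine ⟨?_, ?_, ?_, ?_⟩ <;> simp only <;> omega

/-- Strictly increasing ends make the exponent at each end unique, so the exponents can be read off
as a function; two sorted lists with the same elements are then equal. -/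
theorem exists_toL_eq {d n : ℕ} (hd : 1 ≤ d) {L : List (ℕ × ℕ)} (hL : IsSuffixData d n L) :
    ∃ c : Fin n → Fin d, toL (col c) n = L := by
  classical
  have huniq : ∀ t t' j, (t, j) ∈ L → (t', j) ∈ L → t = t' := by
    intro t t' j ht ht'
    by_contra hne
    have hsymm : Std.Symm fun a b : ℕ × ℕ => a ≠ b → a.2 ≠ b.2 :=
      ⟨fun a b h hne he => h hne.symm he.symm⟩
    have key : ∀ a ∈ L, ∀ b ∈ L, a ≠ b → a.2 ≠ b.2 := fun a ha b hb =>
      List.Pairwise.forall_of_forall (R := fun a b : ℕ × ℕ => a ≠ b → a.2 ≠ b.2)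
        (fun x _ h => absurd rfl h) (hL.2.imp fun h _ => h.ne) ha hb
    exact key _ ht _ ht' (fun h => hne (congrArg Prod.fst h)) rfl
  have hex : ∀ j : Fin n, ∃ t : Fin d, (t.val ≠ 0 → (t.val, j.val + 1) ∈ L) ∧
      ∀ t', (t', j.val + 1) ∈ L → t.val = t' := by
    intro j
    by_cases h : ∃ t, (t, j.val + 1) ∈ L
    · obtain ⟨t, ht⟩ := h
      exact ⟨⟨t, (hL.1 _ ht).2.1⟩, fun _ => ht, fun t' ht' => huniq _ _ _ ht ht'⟩
    · exact ⟨⟨0, hd⟩, fun h0 => absurd rfl h0, fun t' ht' => absurd ⟨t', ht'⟩ h⟩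
  choose c hc1 hc2 using hex
  refine ⟨c, ?_⟩
  have hnodup : ∀ {l : List (ℕ × ℕ)}, (l.Pairwise fun a b => a.2 < b.2) → l.Nodup :=
    fun h => h.imp fun h' he => by rw [he] at h'; exact lt_irrefl _ h'
  have hperm : (toL (col c) n).Perm L := by
    rw [List.perm_ext_iff_of_nodup (hnodup (pairwise_toL _ _)) (hnodup hL.2)]
    rintro ⟨t, j⟩
    rw [mem_toL]
    constructor
    · rintro ⟨i, hi, h0, h⟩
      simp only [Prod.mk.injEq, col, dif_pos hi] at h h0
      rw [h.1, h.2]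
      exact hc1 ⟨i, hi⟩ h0
    · intro h
      obtain ⟨h1, h2, h3, h4⟩ := hL.1 _ h
      simp only at h1 h2 h3 h4
      obtain ⟨i, rfl⟩ : ∃ i, j = i + 1 := ⟨j - 1, by omega⟩
      have := hc2 ⟨i, h4⟩ t h
      refine ⟨i, h4, ?_, ?_⟩
      · rw [col, dif_pos (by omega), this]; omega
      · rw [col, dif_pos (by omega), this]
  exact hperm.eq_of_pairwise (fun a b _ _ h h' => absurd (h.trans h') (lt_irrefl _))
    (pairwise_toL _ _) hL.2

theorem toL_eq_nil {m : ℕ} {c : ℕ → ℕ} (h : ∀ i < m, c i = 0) : toL c m = [] := by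
  rw [List.eq_nil_iff_forall_not_mem]
  intro b hb
  obtain ⟨j, hj, hc, -⟩ := mem_toL.1 hb
  exact hc (h j hj)

theorem toL_eq_cons {m j : ℕ} {c : ℕ → ℕ} (hj : j < m) (hc : c j ≠ 0) (h : ∀ i < j, c i = 0) :
    toL c m = (c j, j + 1) :: toL (Function.update c j 0) m := by
  induction m with
  | zero => omega
  | succ m ih =>
    rcases Nat.lt_succ_iff_lt_or_eq.1 hj with hj' | rfl
    · rw [toL, ih hj', toL, Function.update_of_ne (by omega)]
      rfl
    · have h1 : ∀ i < j + 1, Function.update c j 0 i = 0 := fun i hi => by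
        by_cases hij : i = j
        · simp [hij]
        · rw [Function.update_of_ne hij]; exact h i (by omega)
      rw [toL, toL_eq_nil h, toL_eq_nil h1, if_neg hc]; rfl

theorem toL_ne_nil {m : ℕ} {c : ℕ → ℕ} (h : ∃ i < m, c i ≠ 0) : ∃ b M, toL c m = b :: M := by
  obtain ⟨i, hi, hc⟩ := h
  have : (c i, i + 1) ∈ toL c m := mem_toL.2 ⟨i, hi, hc, rfl⟩
  cases hL : toL c m with
  | nil => rw [hL] at this; simp at this
  | cons b M => exact ⟨b, M, rfl⟩

/-- The trichotomy of suffixes: empty, one block, or several blocks. -/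
theorem suffix_cases (N : ℕ) (c : ℕ → ℕ) :
    (∀ i ≤ N, c i = 0) ∨ ∃ j ≤ N, c j ≠ 0 ∧ (∀ i < j, c i = 0) ∧
      ((∀ i, j < i → i ≤ N → c i = 0) ∨ ∃ i, j < i ∧ i ≤ N ∧ c i ≠ 0) := by
  classical
  by_cases h0 : ∀ i ≤ N, c i = 0
  · exact Or.inl h0
  · push Not at h0
    have hex : ∃ i, i ≤ N ∧ c i ≠ 0 := h0
    obtain ⟨hjN, hcj⟩ := Nat.find_spec hex
    refine Or.inr ⟨Nat.find hex, hjN, hcj, fun i hi => ?_, ?_⟩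
    · by_contra hne
      exact Nat.find_min hex hi ⟨by omega, hne⟩
    · by_cases hz : ∀ i, Nat.find hex < i → i ≤ N → c i = 0
      · exact Or.inl hz
      · push Not at hz
        exact Or.inr hz

theorem packetLabel_empty {N k : ℕ} {c : ℕ → ℕ} (h : ∀ i ≤ N, c i = 0) :
    PacketLabel (N + 1) k (toL c (N + 1)) ↔ k = N + 1 := by
  rw [toL_eq_nil fun i hi => h i (by omega)]
  simp [PacketLabel]

/-- The minimum arises because blocks ending at either of the last two letters share one packet. -/
theorem packetLabel_single {N j k : ℕ} {c : ℕ → ℕ} (hj : j ≤ N) (hc : c j ≠ 0)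
    (h : ∀ i < j, c i = 0) (h' : ∀ i, j < i → i ≤ N → c i = 0) :
    PacketLabel (N + 1) k (toL c (N + 1)) ↔ k = min (j + 1) N := by
  have h1 : toL (Function.update c j 0) (N + 1) = [] := toL_eq_nil fun i hi => by
    by_cases hij : i = j
    · simp [hij]
    · rw [Function.update_of_ne hij]
      rcases Nat.lt_or_ge i j with h2 | h2
      · exact h i h2
      · exact h' i (by omega) (by omega)
  rw [toL_eq_cons (by omega) hc h, h1]
  have h2 : (∃ t, c j = t ∧ j = N ∨ c j = t ∧ j + 1 = N) ↔ j = N ∨ j + 1 = N := by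
    constructor
    · rintro ⟨t, h | h⟩ <;> omega
    · rintro (h | h)
      · exact ⟨c j, Or.inl ⟨rfl, h⟩⟩
      · exact ⟨c j, Or.inr ⟨rfl, h⟩⟩
  simp [PacketLabel, h2]
  omega

theorem packetLabel_multi {N j k : ℕ} {c : ℕ → ℕ} (hc : c j ≠ 0)
    (h : ∀ i < j, c i = 0) (h' : ∃ i, j < i ∧ i ≤ N ∧ c i ≠ 0) :
    PacketLabel (N + 1) k (toL c (N + 1)) ↔ k = j := by
  obtain ⟨i, hji, hi, hci⟩ := h'
  obtain ⟨b, M, h1⟩ : ∃ b M, toL (Function.update c j 0) (N + 1) = b :: M :=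
    toL_ne_nil ⟨i, by omega, by rwa [Function.update_of_ne (by omega)]⟩
  rw [toL_eq_cons (by omega) hc h, h1]
  simp [PacketLabel]
  omega

/-! ### Suffix words and collections -/

theorem filter_dsc (i j m : ℕ) :
    (dsc m 0).filter (fun a => j ≤ a + 1 ∧ a + 1 ≤ i) = dsc (min i m) (j - 1) := by
  induction m with
  | zero => simp [dsc]
  | succ m ih =>
    rw [dsc_succ (Nat.zero_le m), List.filter_cons, ih]
    by_cases h : m + 1 ≤ i
    · rw [min_eq_right h, min_eq_right (by omega : m ≤ i)]
      by_cases h' : j ≤ m + 1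
      · rw [dsc_succ (by omega)]
        simp [h, h']
      · rw [dsc_of_le (by omega), dsc_of_le (by omega)]
        simp [h']
    · rw [min_eq_left (by omega : i ≤ m + 1), min_eq_left (by omega : i ≤ m)]
      simp [h]

theorem reverse_range (n : ℕ) : (List.range n).reverse = dsc n 0 := by
  induction n with
  | zero => rfl
  | succ n ih => rw [List.range_succ, List.reverse_append, ih, dsc_succ (Nat.zero_le n)]; rfl

theorem map_val_descWord {n i : ℕ} (j : ℕ) (hi : i ≤ n) :
    (descWord n i j).map Fin.val = dsc i (j - 1) := by
  have h := filter_dsc i j n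
  rw [min_eq_left hi, ← reverse_range, ← List.map_coe_finRange_eq_range, ← List.map_reverse,
    List.filter_map] at h
  rw [← h]
  rfl

theorem map_val_block (N k j : ℕ) :
    (block (N + 1) k (j + 1)).map Fin.val = List.replicate k N ++ dsc N j := by
  have h : (descWord (N + 1) (N + 1) (N + 1)).map Fin.val = [N] := by
    rw [map_val_descWord _ le_rfl, Nat.add_sub_cancel, dsc_succ le_rfl, dsc_of_le le_rfl]
  rw [block, List.map_append, map_val_descWord _ (by omega)]
  congr 1
  rw [List.map_flatten, List.map_replicate, h]
  induction k with
  | zero => rfl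
  | succ k ih => rw [List.replicate_succ, List.flatten_cons, ih, List.replicate_succ]; rfl

theorem map_val_suffixWord (N : ℕ) (c : ℕ → ℕ) (m : ℕ) :
    (suffixWord (N + 1) (toL c m)).map Fin.val = sufTo N c m := by
  induction m with
  | zero => rfl
  | succ m ih =>
    rw [suffixWord] at ih
    rw [toL, suffixWord, List.map_append, List.flatten_append, List.map_append, ih, sufTo]
    congr 1
    rw [blk]
    split_ifs with h
    · rfl
    · simpa using map_val_block N (c m) m

theorem good_emptyPre (m k : ℕ) : Good m k (emptyPre m) := by
  induction m with
  | zero => trivial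
  | succ m ih => exact Or.inl ⟨rfl, ih⟩

theorem isGood_emptyPre (N : ℕ) (c : ℕ → ℕ) : IsGood N (emptyPre N) c := by
  rcases suffix_cases N c with h | ⟨j, hj, hc, h, h' | h'⟩
  · exact Or.inl ⟨h, good_emptyPre _ _⟩
  · exact Or.inr ⟨j, hj, hc, h, Or.inl ⟨h', good_goodAsc (good_emptyPre _ _)⟩⟩
  · exact Or.inr ⟨j, hj, hc, h, Or.inr ⟨h', good_emptyPre _ _⟩⟩

theorem map_val_suffixWord_eq_canonWord {d N : ℕ} (c : Fin (N + 1) → Fin d) :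
    (suffixWord (N + 1) (toL (col c) (N + 1))).map Fin.val = canonWord (emptyPre N, c) := by
  rw [map_val_suffixWord, canonWord, canon, preWord_emptyPre]; rfl

theorem isPrefixWord_nil (n : ℕ) : IsPrefixWord n [] := by
  refine ⟨fun p => p + 1, fun p _ _ => ⟨Nat.le_add_left 1 p, le_rfl⟩, ?_⟩
  symm
  rw [List.flatten_eq_nil_iff]
  intro l hl
  obtain ⟨p, -, rfl⟩ := List.mem_map.1 hl
  rw [descWord, List.filter_eq_nil_iff]
  intro a _
  simp only [decide_eq_true_eq]
  omega

theorem suffixWord_mem_collection {d N : ℕ} (hd : 1 ≤ d) (c : Fin (N + 1) → Fin d) :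
    suffixWord (N + 1) (toL (col c) (N + 1)) ∈
      collection d (N + 1) (suffixWord (N + 1) (toL (col c) (N + 1))) := by
  refine ⟨[], isPrefixWord_nil _, rfl, ?_⟩
  rw [← wp_map_val, map_val_suffixWord_eq_canonWord, isFullyCommutative_iff hd]
  exact isGood_emptyPre _ _

/-- Each suffix lies in its own collection, via the empty prefix. If two collections coincide, each
suffix ends in the other, so they agree as words, and canonical parameters are unique. Thus packets
can be counted by suffixes. -/
theorem collection_injective {d N : ℕ} (hd : 1 ≤ d) :
    Function.Injective fun c : Fin (N + 1) → Fin d =>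
      collection d (N + 1) (suffixWord (N + 1) (toL (col c) (N + 1))) := by
  intro c c' h
  simp only at h
  have h1 := suffixWord_mem_collection hd c
  rw [h] at h1
  have h2 := suffixWord_mem_collection hd c'
  rw [← h] at h2
  obtain ⟨u, -, hu, -⟩ := h1
  obtain ⟨u', -, hu', -⟩ := h2
  have hlen := congrArg List.length hu
  have hlen' := congrArg List.length hu'
  rw [List.length_append] at hlen hlen'
  obtain rfl : u = [] := List.eq_nil_of_length_eq_zero (by omega)
  have h3 := congrArg (List.map Fin.val) hu
  rw [List.nil_append, map_val_suffixWord_eq_canonWord, map_val_suffixWord_eq_canonWord] at h3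
  have h4 := wp_canonWord_injective hd N (congrArg (wp d N) h3)
  exact congrArg Prod.snd h4

/-! ### Packet sizes and the number of prefixes admitted by a suffix -/

open scoped Classical in
theorem ncard_packet {d : ℕ} (hd : 1 ≤ d) (N k : ℕ) :
    (packet d (N + 1) k).ncard =
      ∑ c : Fin (N + 1) → Fin d,
        if PacketLabel (N + 1) k (toL (col c) (N + 1)) then 1 else 0 := by
  have h : packet d (N + 1) k =
      (fun c : Fin (N + 1) → Fin d =>
        collection d (N + 1) (suffixWord (N + 1) (toL (col c) (N + 1)))) ''
      {c | PacketLabel (N + 1) k (toL (col c) (N + 1))} := by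
    ext s
    constructor
    · rintro ⟨L, hL, hk, rfl⟩
      obtain ⟨c, rfl⟩ := exists_toL_eq hd hL
      exact ⟨c, hk, rfl⟩
    · rintro ⟨c, hk, rfl⟩
      exact ⟨_, isSuffixData_toL c, hk, rfl⟩
  rw [h, Set.ncard_image_of_injective _ (collection_injective hd), Finset.sum_boole,
    Set.ncard_eq_toFinset_card', Set.toFinset_ofPred]
  rfl

open scoped Classical in
theorem ncard_fullyCommutative {d : ℕ} (hd : 1 ≤ d) (N : ℕ) :
    {w : G d (N + 1) | IsFullyCommutative d (N + 1) w}.ncard =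
      ∑ c : Fin (N + 1) → Fin d, ∑ x : PreData N, if IsGood N x (col c) then 1 else 0 := by
  have h : {w : G d (N + 1) | IsFullyCommutative d (N + 1) w} =
      (fun p : CanonData d N => wp d N (canonWord p)) '' {p | IsGood N p.1 (col p.2)} := by
    ext w
    constructor
    · intro hw
      obtain ⟨p, rfl⟩ := wp_canonWord_surjective hd N w
      exact ⟨p, (isFullyCommutative_iff hd p).1 hw, rfl⟩
    · rintro ⟨p, hp, rfl⟩
      exact (isFullyCommutative_iff hd p).2 hp
  rw [h, Set.ncard_image_of_injective _ (wp_canonWord_injective hd N),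
    Set.ncard_eq_toFinset_card', Set.toFinset_ofPred, Finset.card_filter,
    Fintype.sum_prod_type_right]

theorem isGood_empty {N : ℕ} {x : PreData N} {c : ℕ → ℕ} (h : ∀ i ≤ N, c i = 0) :
    IsGood N x c ↔ Good N N x := by
  constructor
  · rintro (⟨-, h'⟩ | ⟨j, hj, hc, -⟩)
    · exact h'
    · exact absurd (h j hj) hc
  · exact fun h' => Or.inl ⟨h, h'⟩

theorem first_unique {j j' : ℕ} {c : ℕ → ℕ} (hc : c j ≠ 0) (h : ∀ i < j, c i = 0)
    (hc' : c j' ≠ 0) (h' : ∀ i < j', c i = 0) : j = j' := by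
  rcases lt_trichotomy j j' with hj | hj | hj
  · exact absurd (h' j hj) hc
  · exact hj
  · exact absurd (h j' hj) hc'

theorem isGood_single {N j : ℕ} {x : PreData N} {c : ℕ → ℕ} (hj : j ≤ N) (hc : c j ≠ 0)
    (h : ∀ i < j, c i = 0) (h' : ∀ i, j < i → i ≤ N → c i = 0) :
    IsGood N x c ↔ GoodAsc N j x := by
  constructor
  · rintro (⟨h0, -⟩ | ⟨j', hj', hc', hlt, h1⟩)
    · exact absurd (h0 j hj) hc
    · obtain rfl := first_unique hc h hc' hlt
      rcases h1 with h1 | ⟨⟨i, hi, hiN, hci⟩, -⟩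
      · exact h1.2
      · exact absurd (h' i hi hiN) hci
  · exact fun hg => Or.inr ⟨j, hj, hc, h, Or.inl ⟨h', hg⟩⟩

theorem isGood_multi {N j : ℕ} {x : PreData N} {c : ℕ → ℕ} (hj : j ≤ N) (hc : c j ≠ 0)
    (h : ∀ i < j, c i = 0) (h' : ∃ i, j < i ∧ i ≤ N ∧ c i ≠ 0) :
    IsGood N x c ↔ Good N j x := by
  constructor
  · rintro (⟨h0, -⟩ | ⟨j', hj', hc', hlt, h1⟩)
    · exact absurd (h0 j hj) hc
    · obtain rfl := first_unique hc h hc' hlt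
      rcases h1 with ⟨h1, -⟩ | h1
      · obtain ⟨i, hi, hiN, hci⟩ := h'
        exact absurd (h1 i hi hiN) hci
      · exact h1.2
  · exact fun hg => Or.inr ⟨j, hj, hc, h, Or.inr ⟨h', hg⟩⟩


open scoped Classical in
/-- The number of admissible prefixes of a suffix. -/
noncomputable def prefixCount (N : ℕ) (c : ℕ → ℕ) : ℕ :=
  ∑ x : PreData N, if IsGood N x c then 1 else 0

theorem prefixCount_empty {N : ℕ} {c : ℕ → ℕ} (h : ∀ i ≤ N, c i = 0) :
    (prefixCount N c : ℚ) = catalanTriangle (N + 1) (N + 1) := by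
  rw [catalanTriangle_succ_self, ← goodCount_eq (Nat.le_succ N)]
  classical
  rw [prefixCount, goodCount]
  exact congrArg _ (Finset.sum_congr rfl fun x _ => if_congr (isGood_empty h) rfl rfl)

theorem prefixCount_single {N j : ℕ} {c : ℕ → ℕ} (hj : j ≤ N) (hc : c j ≠ 0)
    (h : ∀ i < j, c i = 0) (h' : ∀ i, j < i → i ≤ N → c i = 0) :
    (prefixCount N c : ℚ) = catalanTriangle (N + 1) (j + 1) := by
  rw [← goodAscCount_eq hj]
  classical
  rw [prefixCount, goodAscCount]
  exact congrArg _ (Finset.sum_congr rfl fun x _ => if_congr (isGood_single hj hc h h') rfl rfl)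

theorem prefixCount_multi {N j : ℕ} {c : ℕ → ℕ} (hj : j ≤ N) (hc : c j ≠ 0)
    (h : ∀ i < j, c i = 0) (h' : ∃ i, j < i ∧ i ≤ N ∧ c i ≠ 0) :
    (prefixCount N c : ℚ) = catalanTriangle (N + 1) j := by
  rw [← goodCount_eq (hj.trans (Nat.le_succ N))]
  classical
  rw [prefixCount, goodCount]
  exact congrArg _ (Finset.sum_congr rfl fun x _ => if_congr (isGood_multi hj hc h h') rfl rfl)

-- Each suffix belongs to exactly one packet, whose Catalan triangle number is its number of
-- admissible prefixes; summing over suffixes gives the packet sum.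
open scoped Classical in
theorem prefixCount_eq_sum_packetLabel {N : ℕ} (c : ℕ → ℕ) :
    (prefixCount N c : ℚ) = ∑ k ∈ Finset.range (N + 2), catalanTriangle (N + 1) k *
      if PacketLabel (N + 1) k (toL c (N + 1)) then 1 else 0 := by
  have key : ∀ k₀, k₀ < N + 2 → (∀ k, PacketLabel (N + 1) k (toL c (N + 1)) ↔ k = k₀) →
      ∑ k ∈ Finset.range (N + 2), catalanTriangle (N + 1) k *
        (if PacketLabel (N + 1) k (toL c (N + 1)) then (1 : ℚ) else 0) =
      catalanTriangle (N + 1) k₀ := by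
    intro k₀ hk₀ h
    simp only [h, mul_ite, mul_one, mul_zero]
    rw [Finset.sum_ite_eq' _ k₀, if_pos (Finset.mem_range.2 hk₀)]
  rcases suffix_cases N c with h | ⟨j, hj, hc, h, h' | h'⟩
  · rw [key (N + 1) (by omega) fun k => packetLabel_empty h, prefixCount_empty h]
  · rw [key (min (j + 1) N) (by omega) fun k => packetLabel_single hj hc h h',
      prefixCount_single hj hc h h']
    rcases Nat.lt_or_ge j N with hlt | hge
    · rw [min_eq_left hlt]
    · obtain rfl : j = N := le_antisymm hj hge
      -- The suffix consisting of a power of the last generator admits C(n,n) prefixes but sits in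
      -- packet n - 1; the two numbers agree.
      rw [min_eq_right (Nat.le_succ j), catalanTriangle_succ_self]
  · rw [key j (by omega) fun k => packetLabel_multi hc h h', prefixCount_multi hj hc h h']

theorem ncard_eq_sum_packet {d : ℕ} (hd : 1 ≤ d) (N : ℕ) :
    ({w : G d (N + 1) | IsFullyCommutative d (N + 1) w}.ncard : ℚ) =
      ∑ k ∈ Finset.range (N + 1 + 1),
        catalanTriangle (N + 1) k * ((packet d (N + 1) k).ncard : ℚ) := by
  classical
  have h1 : {w : G d (N + 1) | IsFullyCommutative d (N + 1) w}.ncard =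
      ∑ c : Fin (N + 1) → Fin d, prefixCount N (col c) := by
    rw [ncard_fullyCommutative hd]; rfl
  rw [h1, Nat.cast_sum, Finset.sum_congr rfl fun c _ => prefixCount_eq_sum_packetLabel (col c),
    Finset.sum_comm]
  refine Finset.sum_congr rfl fun k _ => ?_
  rw [ncard_packet hd, Nat.cast_sum, Finset.mul_sum]
  refine Finset.sum_congr rfl fun c _ => ?_
  push_cast
  rfl

/-! ### The explicit count -/

/-- The first nonzero exponent is the one of index `j`. -/
def First (c : ℕ → ℕ) (j : ℕ) : Prop := c j ≠ 0 ∧ ∀ i < j, c i = 0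

/-- The exponent of index `j` is the only nonzero one. -/
def Single (N : ℕ) (c : ℕ → ℕ) (j : ℕ) : Prop := First c j ∧ ∀ i, j < i → i ≤ N → c i = 0

-- Every nonempty suffix is charged C(n,j) as if it had several blocks, and single blocks receive
-- the correction. The resulting indicators are easy to sum over all exponents.
open scoped Classical in
theorem prefixCount_eq_sum_first (N : ℕ) (c : ℕ → ℕ) :
    (prefixCount N c : ℚ) = (if ∀ i < N + 1, c i = 0 then catalanTriangle (N + 1) (N + 1) else 0) +
      ∑ j ∈ Finset.range (N + 1), ((if First c j then catalanTriangle (N + 1) j else 0) +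
        if Single N c j then catalanTriangle (N + 1) (j + 1) - catalanTriangle (N + 1) j else 0) := by
  rcases suffix_cases N c with h | ⟨j, hj, hc, h, h'⟩
  · rw [if_pos fun i hi => h i (by omega), Finset.sum_eq_zero, add_zero, prefixCount_empty h]
    intro j hj
    have hF : ¬ First c j := fun hF => hF.1 (h j (by rw [Finset.mem_range] at hj; omega))
    rw [if_neg hF, if_neg fun hS => hF hS.1, add_zero]
  · have hF : First c j := ⟨hc, h⟩
    rw [if_neg fun h0 => hc (h0 j (by omega)), zero_add, Finset.sum_eq_single j]
    · rw [if_pos hF]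
      rcases h' with h' | h'
      · rw [if_pos ⟨hF, h'⟩, prefixCount_single hj hc h h']
        ring
      · have hS : ¬ Single N c j := fun hS => by
          obtain ⟨i, hi, hiN, hci⟩ := h'
          exact hci (hS.2 i hi hiN)
        rw [if_neg hS, prefixCount_multi hj hc h h', add_zero]
    · intro i _ hij
      have hF' : ¬ First c i := fun hF' => hij (first_unique hF'.1 hF'.2 hc h)
      rw [if_neg hF', if_neg fun hS => hF' hS.1, add_zero]
    · intro hj'
      exact absurd (Finset.mem_range.2 (by omega)) hj'

open scoped Classical in
theorem card_zero_below {d n j : ℕ} (hd : 1 ≤ d) (hj : j ≤ n) :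
    (∑ c : Fin n → Fin d, if ∀ i < j, col c i = 0 then (1 : ℚ) else 0) = (d : ℚ) ^ (n - j) := by
  have : NeZero d := ⟨by omega⟩
  have h : (Finset.univ.filter fun c : Fin n → Fin d => ∀ i < j, col c i = 0) =
      Fintype.piFinset fun i : Fin n => if i.val < j then ({0} : Finset (Fin d)) else Finset.univ := by
    ext c
    rw [Finset.mem_filter, Fintype.mem_piFinset]
    constructor
    · rintro ⟨-, h⟩ i
      split_ifs with hi
      · have := h i hi
        rw [col, dif_pos i.2] at this
        exact Finset.mem_singleton.2 (Fin.ext this)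
      · exact Finset.mem_univ _
    · refine fun h => ⟨Finset.mem_univ _, fun i hi => ?_⟩
      have := h ⟨i, by omega⟩
      rw [if_pos hi, Finset.mem_singleton] at this
      rw [col, dif_pos (by omega), this]
      rfl
  rw [Finset.sum_boole, h, Fintype.card_piFinset]
  have h2 : ∀ i : Fin n, (if i.val < j then ({0} : Finset (Fin d)) else Finset.univ).card =
      if i.val < j then 1 else d := by
    intro i
    split_ifs <;> simp
  rw [Finset.prod_congr rfl fun i _ => h2 i,
    Fin.prod_univ_eq_prod_range (fun i => if i < j then 1 else d) n]
  obtain ⟨m, rfl⟩ : ∃ m, n = j + m := ⟨n - j, by omega⟩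
  rw [Finset.prod_range_add, Finset.prod_congr rfl fun i hi => if_pos (Finset.mem_range.1 hi),
    Finset.prod_congr (s₁ := Finset.range m) rfl fun i _ => if_neg (by omega : ¬ j + i < j)]
  simp

-- Subtract the functions vanishing on the first j + 1 indices from those vanishing on the first j.
open scoped Classical in
theorem card_first {d n j : ℕ} (hd : 1 ≤ d) (hj : j < n) :
    (∑ c : Fin n → Fin d, if First (col c) j then (1 : ℚ) else 0) =
      (d : ℚ) ^ (n - j) - (d : ℚ) ^ (n - (j + 1)) := by
  rw [← card_zero_below hd hj.le, ← card_zero_below hd (by omega : j + 1 ≤ n), ← Finset.sum_sub_distrib]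
  refine Finset.sum_congr rfl fun c _ => ?_
  have h : (∀ i < j + 1, col c i = 0) ↔ (∀ i < j, col c i = 0) ∧ col c j = 0 := by
    constructor
    · exact fun h => ⟨fun i hi => h i (by omega), h j (by omega)⟩
    · rintro ⟨h, h'⟩ i hi
      rcases Nat.lt_succ_iff_lt_or_eq.1 hi with hi | rfl
      · exact h i hi
      · exact h'
  rw [if_congr h rfl rfl]
  by_cases h1 : ∀ i < j, col c i = 0
  · by_cases h2 : col c j = 0
    · rw [if_neg fun hF => hF.1 h2, if_pos h1, if_pos ⟨h1, h2⟩, sub_self]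
    · rw [if_pos ⟨h2, h1⟩, if_pos h1, if_neg fun h => h2 h.2, sub_zero]
  · rw [if_neg fun hF => h1 hF.2, if_neg h1, if_neg fun h => h1 h.1, sub_self]

open scoped Classical in
theorem card_single {d N j : ℕ} (hd : 1 ≤ d) (hj : j ≤ N) :
    (∑ c : Fin (N + 1) → Fin d, if Single N (col c) j then (1 : ℚ) else 0) = (d : ℚ) - 1 := by
  have : NeZero d := ⟨by omega⟩
  have h : (Finset.univ.filter fun c : Fin (N + 1) → Fin d => Single N (col c) j) =
      Fintype.piFinset fun i : Fin (N + 1) => if i = ⟨j, by omega⟩ then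
        Finset.univ.erase (0 : Fin d) else {0} := by
    ext c
    rw [Finset.mem_filter, Fintype.mem_piFinset]
    constructor
    · rintro ⟨-, ⟨h1, h2⟩, h3⟩ i
      split_ifs with hi
      · rw [Finset.mem_erase]
        refine ⟨fun h0 => h1 ?_, Finset.mem_univ _⟩
        rw [col, dif_pos (by omega), ← hi, h0]
        rfl
      · have h4 : col c i = 0 := by
          rcases lt_trichotomy i.val j with hlt | heq | hgt
          · exact h2 i hlt
          · exact absurd (Fin.ext heq) hi
          · exact h3 i hgt (by omega)
        rw [col, dif_pos i.2] at h4
        exact Finset.mem_singleton.2 (Fin.ext h4)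
    · intro h
      have h0 : ∀ i, i ≤ N → i ≠ j → col c i = 0 := by
        intro i hi hij
        have := h ⟨i, by omega⟩
        rw [if_neg (by simpa using hij), Finset.mem_singleton] at this
        rw [col, dif_pos (by omega), this]
        rfl
      refine ⟨Finset.mem_univ _, ⟨?_, fun i hi => h0 i (by omega) (by omega)⟩,
        fun i hi hiN => h0 i hiN (by omega)⟩
      have h5 := h ⟨j, by omega⟩
      rw [if_pos rfl, Finset.mem_erase] at h5
      rw [col, dif_pos (by omega)]
      exact fun h6 => h5.1 (Fin.ext h6)
  rw [Finset.sum_boole, h, Fintype.card_piFinset, Finset.prod_eq_single (⟨j, by omega⟩ : Fin (N + 1))]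
  · rw [if_pos rfl, Finset.card_erase_of_mem (Finset.mem_univ _), Finset.card_univ, Fintype.card_fin,
      Nat.cast_sub hd, Nat.cast_one]
  · intro i _ hi
    rw [if_neg hi, Finset.card_singleton]
  · intro h
    exact absurd (Finset.mem_univ _) h

/-- The number of fully commutative elements of `G(d,1,N+1)`. -/
theorem ncard_fullyCommutative_eq {d N : ℕ} (hd : 1 ≤ d) (hN : 1 ≤ N) :
    ({w : G d (N + 1) | IsFullyCommutative d (N + 1) w}.ncard : ℚ) =
      (d : ℚ) * ((d : ℚ) - 1) * (catalanTrianglePoly (N + 1) (N + 1 - 2)).eval (d : ℚ)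
        + (2 * (d : ℚ) - 1) * (catalan (N + 1) : ℚ) - ((d : ℚ) - 1) := by
  classical
  have h1 : {w : G d (N + 1) | IsFullyCommutative d (N + 1) w}.ncard =
      ∑ c : Fin (N + 1) → Fin d, prefixCount N (col c) := by
    rw [ncard_fullyCommutative hd]; rfl
  set f := catalanTriangle (N + 1) with hf
  have hmul : ∀ (p : Prop) [Decidable p] (a : ℚ), (if p then a else 0) = a * if p then 1 else 0 :=
    fun p _ a => by split_ifs <;> simp
  have h2 : ({w : G d (N + 1) | IsFullyCommutative d (N + 1) w}.ncard : ℚ) =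
      f (N + 1) + ∑ j ∈ Finset.range (N + 1),
        (f j * ((d : ℚ) ^ (N + 1 - j) - (d : ℚ) ^ (N + 1 - (j + 1))) +
          (f (j + 1) - f j) * ((d : ℚ) - 1)) := by
    rw [h1, Nat.cast_sum, Finset.sum_congr rfl fun c _ => prefixCount_eq_sum_first N (col c),
      Finset.sum_add_distrib, Finset.sum_comm, Finset.sum_congr rfl fun c _ => hmul _ (f (N + 1)),
      ← Finset.mul_sum, card_zero_below hd le_rfl, Nat.sub_self, pow_zero, mul_one]
    congr 1
    refine Finset.sum_congr rfl fun j hj => ?_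
    rw [Finset.mem_range] at hj
    rw [Finset.sum_add_distrib, Finset.sum_congr rfl fun c _ => hmul _ (f j), ← Finset.mul_sum,
      card_first hd hj, Finset.sum_congr rfl fun c _ => hmul _ (f (j + 1) - f j),
      ← Finset.mul_sum, card_single hd (by omega)]
  obtain ⟨m, rfl⟩ : ∃ m, N = m + 1 := ⟨N - 1, by omega⟩
  have h3 : f 0 = 1 := catalanTriangle_zero _
  have h4 : f (m + 1 + 1) = catalan (m + 1 + 1) := catalanTriangle_self _
  have h5 : f (m + 1) = catalan (m + 1 + 1) := by rw [← h4]; exact (catalanTriangle_succ_self _).symm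
  have h6 : ∑ j ∈ Finset.range (m + 1),
      f j * ((d : ℚ) ^ (m + 1 + 1 - j) - (d : ℚ) ^ (m + 1 + 1 - (j + 1))) =
        (d : ℚ) * ((d : ℚ) - 1) * ∑ s ∈ Finset.range (m + 1), f s * (d : ℚ) ^ (m - s) := by
    rw [Finset.mul_sum]
    refine Finset.sum_congr rfl fun j hj => ?_
    rw [Finset.mem_range] at hj
    rw [(by omega : m + 1 + 1 - j = m - j + 2), (by omega : m + 1 + 1 - (j + 1) = m - j + 1)]
    ring
  -- The corrections telescope to (d - 1)(C(n,n) - C(n,0)). In the main sum the last term gives (d -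
  -- 1) C(n,n-1), and the remaining terms have a factor d(d - 1) leaving the Catalan triangle
  -- polynomial.
  rw [h2, Finset.sum_add_distrib, ← Finset.sum_mul, Finset.sum_range_sub, h4, h3,
    Finset.sum_range_succ, h6, h5, eval_catalanTrianglePoly]
  simp
  ring

/-! ### The Coxeter group of type `B` -/

section Involutions

variable {H : Type*} [Group H] {x y : H}

/-- This and the next two results translate between the Coxeter form of a relation and its braid
form, using that involutions are their own inverses. -/
theorem mul_pow_two_eq_one_iff (hx : x * x = 1) (hy : y * y = 1) :
    (x * y) ^ 2 = 1 ↔ x * y = y * x := by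
  rw [pow_two, mul_eq_one_iff_eq_inv, mul_inv_rev, inv_eq_of_mul_eq_one_left hx,
    inv_eq_of_mul_eq_one_left hy]

theorem mul_pow_three_eq_one_iff (hx : x * x = 1) (hy : y * y = 1) :
    (x * y) ^ 3 = 1 ↔ y * x * y = x * y * x := by
  have h : (y * x * y)⁻¹ = y * x * y := by
    rw [mul_inv_rev, mul_inv_rev, inv_eq_of_mul_eq_one_left hx, inv_eq_of_mul_eq_one_left hy,
      mul_assoc]
  have h' : (x * y) ^ 3 = x * y * x * (y * x * y) := by
    rw [pow_succ, pow_two]; simp only [mul_assoc]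
  rw [h', mul_eq_one_iff_eq_inv, h, eq_comm]

theorem mul_pow_four_eq_one_iff (hx : x * x = 1) (hy : y * y = 1) :
    (x * y) ^ 4 = 1 ↔ y * x * y * x = x * y * x * y := by
  have h : (x * y * x * y)⁻¹ = y * x * y * x := by
    simp only [mul_inv_rev, inv_eq_of_mul_eq_one_left hx, inv_eq_of_mul_eq_one_left hy, mul_assoc]
  have h' : (x * y) ^ 4 = x * y * x * y * (x * y * x * y) := by
    rw [pow_succ, pow_succ, pow_two]; simp only [mul_assoc]
  rw [h', mul_eq_one_iff_eq_inv, h, eq_comm]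

end Involutions

theorem coxeterB_apply {n : ℕ} (i j : Fin n) : CoxeterMatrix.B n i j =
    if i = j then 1
      else if i.val = n - 1 ∧ j.val = n - 2 ∨ j.val = n - 1 ∧ i.val = n - 2 then 4
        else if j.val + 1 = i.val ∨ i.val + 1 = j.val then 3 else 2 := rfl

theorem coxeterB_eq_two_iff {n : ℕ} (i j : Fin n) :
    CoxeterMatrix.B n i j = 2 ↔ j.val + 1 < i.val ∨ i.val + 1 < j.val := by
  have hi := i.2
  have hj := j.2
  rw [coxeterB_apply]
  split_ifs with h1 h2 h3
  · subst h1; simp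
  · simp; omega
  · simp; omega
  · rw [Fin.ext_iff] at h1
    simp; omega

theorem coxeterB_braid {n : ℕ} {i j : Fin n} (hij : j.val = i.val + 1) (hj : j.val + 1 < n) :
    CoxeterMatrix.B n i j = 3 := by
  rw [coxeterB_apply, if_neg (by rw [Fin.ext_iff]; omega), if_neg (by omega), if_pos (by omega)]

theorem coxeterB_last {n : ℕ} {i j : Fin n} (hij : j.val = i.val + 1) (hj : j.val + 1 = n) :
    CoxeterMatrix.B n i j = 4 := by
  rw [coxeterB_apply, if_neg (by rw [Fin.ext_iff]; omega), if_pos (by omega)]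

/-- The Coxeter system of type `B`. -/
abbrev csB (n : ℕ) : CoxeterSystem (CoxeterMatrix.B n) (CoxeterMatrix.B n).Group :=
  (CoxeterMatrix.B n).toCoxeterSystem

theorem simpleB_relators (n : ℕ) :
    ∀ r ∈ relators 2 n, FreeGroup.lift (csB n).simple r = 1 := by
  have hsq := (csB n).simple_mul_simple_self
  have hpow := (csB n).simple_mul_simple_pow
  rintro r ((((⟨i, hi, rfl⟩ | ⟨i, hi, rfl⟩) | ⟨i, j, hij, rfl⟩) | ⟨i, j, hij, hj, rfl⟩) |
    ⟨i, j, hij, hj, rfl⟩)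
  · rw [map_pow, FreeGroup.lift_apply_of, pow_two, hsq]
  · rw [map_pow, FreeGroup.lift_apply_of, pow_two, hsq]
  · have h := hpow i j
    rw [(coxeterB_eq_two_iff i j).2 (Or.inl hij), mul_pow_two_eq_one_iff (hsq i) (hsq j)] at h
    rw [map_mul, map_inv, mul_inv_eq_one]
    simpa only [map_mul, FreeGroup.lift_apply_of] using h
  · have h := hpow i j
    rw [coxeterB_braid hij hj, mul_pow_three_eq_one_iff (hsq i) (hsq j)] at h
    rw [map_mul, map_inv, mul_inv_eq_one]
    simpa only [map_mul, FreeGroup.lift_apply_of] using h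
  · have h := hpow i j
    rw [coxeterB_last hij hj, mul_pow_four_eq_one_iff (hsq i) (hsq j)] at h
    rw [map_mul, map_inv, mul_inv_eq_one]
    simpa only [map_mul, FreeGroup.lift_apply_of] using h

theorem of_isLiftable (n : ℕ) :
    (CoxeterMatrix.B n).IsLiftable fun i => (PresentedGroup.of i : G 2 n) := by
  have hsq : ∀ i : Fin n, (PresentedGroup.of i : G 2 n) * PresentedGroup.of i = 1 := by
    intro i
    have h : FreeGroup.of i ^ 2 ∈ relators 2 n := by
      by_cases hi : i.val + 1 = n
      · exact Or.inl (Or.inl (Or.inl (Or.inl ⟨i, hi, rfl⟩)))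
      · exact Or.inl (Or.inl (Or.inl (Or.inr ⟨i, by omega, rfl⟩)))
    rw [← pow_two]
    exact PresentedGroup.one_of_mem h
  have hsymm : ∀ {x y : G 2 n} {k : ℕ}, x * x = 1 → y * y = 1 → (x * y) ^ k = 1 →
      (y * x) ^ k = 1 := by
    intro x y k hx hy h
    have h1 : (x * y)⁻¹ = y * x := by
      rw [mul_inv_rev, inv_eq_of_mul_eq_one_left hx, inv_eq_of_mul_eq_one_left hy]
    rw [← h1, inv_pow, h, inv_one]
  have key : ∀ i j : Fin n, i.val < j.val →
      ((PresentedGroup.of i : G 2 n) * PresentedGroup.of j) ^ (CoxeterMatrix.B n i j) = 1 := by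
    intro i j hij
    rcases Nat.lt_or_ge (i.val + 1) j.val with h | h
    · rw [(coxeterB_eq_two_iff i j).2 (Or.inr h), mul_pow_two_eq_one_iff (hsq i) (hsq j)]
      exact (mk_eq_of_mem_relators (Or.inl (Or.inl (Or.inr ⟨j, i, h, rfl⟩)))).symm
    · have hij' : j.val = i.val + 1 := by omega
      rcases Nat.lt_or_ge (j.val + 1) n with hj | hj
      · rw [coxeterB_braid hij' hj, mul_pow_three_eq_one_iff (hsq i) (hsq j)]
        exact mk_eq_of_mem_relators (Or.inl (Or.inr ⟨i, j, hij', hj, rfl⟩))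
      · have hj' : j.val + 1 = n := by omega
        rw [coxeterB_last hij' hj', mul_pow_four_eq_one_iff (hsq i) (hsq j)]
        exact mk_eq_of_mem_relators (Or.inr ⟨i, j, hij', hj', rfl⟩)
  intro i j
  rcases lt_trichotomy i.val j.val with h | h | h
  · exact key i j h
  · obtain rfl := Fin.ext h
    rw [(CoxeterMatrix.B n).diagonal, pow_one, hsq]
  · rw [(CoxeterMatrix.B n).symmetric]
    exact hsymm (hsq j) (hsq i) (key j i h)

/-- The isomorphism between `G(2,1,n)` and the Coxeter group of type `B`. -/
def equivB (n : ℕ) : G 2 n ≃* (CoxeterMatrix.B n).Group :=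
  MonoidHom.toMulEquiv (PresentedGroup.toGroup (simpleB_relators n))
    ((csB n).lift ⟨fun i => (PresentedGroup.of i : G 2 n), of_isLiftable n⟩)
    (PresentedGroup.ext fun i => by
      rw [MonoidHom.comp_apply, PresentedGroup.toGroup.of, CoxeterSystem.lift_apply_simple]; rfl)
    ((csB n).ext_simple fun i => by
      rw [MonoidHom.comp_apply, CoxeterSystem.lift_apply_simple, PresentedGroup.toGroup.of]; rfl)

theorem equivB_wordProd (n : ℕ) (u : List (Fin n)) :
    equivB n (wordProd 2 n u) = (csB n).wordProd u := by
  rw [wordProd, CoxeterSystem.wordProd, map_list_prod, List.map_map]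
  congr 1

theorem isReduced_iff_forall_length_le {n : ℕ} (u : List (Fin n)) :
    (csB n).IsReduced u ↔
      ∀ v, (csB n).wordProd v = (csB n).wordProd u → u.length ≤ v.length := by
  constructor
  · intro h v hv
    have h1 := (csB n).length_wordProd_le v
    rw [hv, h.eq] at h1
    exact h1
  · intro h
    obtain ⟨v, hv, hu⟩ := (csB n).exists_isReduced ((csB n).wordProd u)
    have h1 := h v hu.symm
    have h2 := hv.eq
    rw [← hu] at h2
    exact le_antisymm ((csB n).length_wordProd_le u) (h2 ▸ h1)

/-- The isomorphism preserves values of words, hence minimal length. The Coxeter commutation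
relation is symmetric and the other is oriented, but they generate the same equivalence. -/
theorem coxeterFullyCommutative_equivB {n : ℕ} (w : G 2 n) :
    CoxeterFullyCommutative (CoxeterMatrix.B n) (equivB n w) ↔ IsFullyCommutative 2 n w := by
  have hred : ∀ u, u ∈ reducedWords 2 n w ↔
      (csB n).IsReduced u ∧ (csB n).wordProd u = equivB n w := by
    intro u
    have h1 : ∀ v, (csB n).wordProd v = equivB n w ↔ wordProd 2 n v = w := fun v => by
      rw [← equivB_wordProd, (equivB n).injective.eq_iff]
    constructor
    · rintro ⟨hu, hmin⟩
      have hu' := (h1 u).2 hu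
      exact ⟨(isReduced_iff_forall_length_le u).2 fun v hv =>
        hmin v ((h1 v).1 (hv.trans hu')), hu'⟩
    · rintro ⟨hu, hu'⟩
      exact ⟨(h1 u).1 hu', fun v hv =>
        (isReduced_iff_forall_length_le u).1 hu v (((h1 v).2 hv).trans hu'.symm)⟩
  have hcomm : ∀ u v : List (Fin n), CommEquiv (fun i j => CoxeterMatrix.B n i j = 2) u v ↔
      CommEquiv (fun i j : Fin n => j.val + 1 < i.val) u v := by
    intro u v
    constructor
    · refine eqvGen_map id ?_
      rintro _ _ ⟨a, b, x, y, hxy, rfl, rfl⟩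
      rcases (coxeterB_eq_two_iff x y).1 hxy with h | h
      · exact .rel _ _ ⟨a, b, x, y, h, rfl, rfl⟩
      · exact .symm _ _ (.rel _ _ ⟨a, b, y, x, h, rfl, rfl⟩)
    · refine eqvGen_map id ?_
      rintro _ _ ⟨a, b, x, y, hxy, rfl, rfl⟩
      exact .rel _ _ ⟨a, b, x, y, (coxeterB_eq_two_iff x y).2 (Or.inl hxy), rfl, rfl⟩
  constructor
  · intro h u hu v hv
    rw [hred] at hu hv
    exact (hcomm u v).1 (h u v hu.1 hv.1 hu.2 hv.2)
  · intro h u v hu hv hu' hv'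
    exact (hcomm u v).2 (h u ((hred u).2 ⟨hu, hu'⟩) v ((hred v).2 ⟨hv, hv'⟩))

theorem ncard_coxeterFullyCommutative (n : ℕ) :
    {w : (CoxeterMatrix.B n).Group | CoxeterFullyCommutative (CoxeterMatrix.B n) w}.ncard =
      {w : G 2 n | IsFullyCommutative 2 n w}.ncard := by
  rw [← Set.ncard_image_of_injective _ (equivB n).injective]
  congr 1
  ext w
  constructor
  · intro hw
    obtain ⟨v, rfl⟩ := (equivB n).surjective w
    exact ⟨v, (coxeterFullyCommutative_equivB v).1 hw, rfl⟩
  · rintro ⟨v, hv, rfl⟩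
    exact (coxeterFullyCommutative_equivB v).2 hv

end FullyComm

theorem corollary4p12 (n : ℕ) (hn : 3 ≤ n) :
    (∀ d : ℕ, 1 ≤ d →
      ({w : FullyComm.G d n | FullyComm.IsFullyCommutative d n w}.ncard : ℚ) =
        ∑ k ∈ Finset.range (n + 1),
          FullyComm.catalanTriangle n k * ((FullyComm.packet d n k).ncard : ℚ) ∧
      ∑ k ∈ Finset.range (n + 1),
          FullyComm.catalanTriangle n k * ((FullyComm.packet d n k).ncard : ℚ) =
        (d : ℚ) * ((d : ℚ) - 1) * (FullyComm.catalanTrianglePoly n (n - 2)).eval (d : ℚ)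
          + (2 * (d : ℚ) - 1) * (catalan n : ℚ) - ((d : ℚ) - 1)) ∧
    ({w : FullyComm.G 2 n | FullyComm.IsFullyCommutative 2 n w}.ncard : ℚ) =
      ((n : ℚ) + 2) * (catalan n : ℚ) - 1 ∧
    ({w : (CoxeterMatrix.B n).Group |
        FullyComm.CoxeterFullyCommutative (CoxeterMatrix.B n) w}.ncard : ℚ) =
      ((n : ℚ) + 2) * (catalan n : ℚ) - 1 := by
  obtain ⟨N, rfl⟩ : ∃ N, n = N + 1 := ⟨n - 1, by omega⟩
  have h2 : ({w : FullyComm.G 2 (N + 1) | FullyComm.IsFullyCommutative 2 (N + 1) w}.ncard : ℚ) =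
      (((N + 1 : ℕ) : ℚ) + 2) * (catalan (N + 1) : ℚ) - 1 := by
    have h := FullyComm.two_mul_eval_two_catalanTrianglePoly (by omega : 2 ≤ N + 1)
    rw [FullyComm.ncard_fullyCommutative_eq (by omega) (by omega)]
    push_cast at h ⊢
    -- At d = 2 the polynomial term is (n - 1) C_n, which joins 3 C_n - 1.
    linear_combination h
  refine ⟨fun d hd => ⟨FullyComm.ncard_eq_sum_packet hd N, ?_⟩, h2, ?_⟩
  · rw [← FullyComm.ncard_eq_sum_packet hd N, FullyComm.ncard_fullyCommutative_eq hd (by omega)]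
  · rw [FullyComm.ncard_coxeterFullyCommutative, h2]
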